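/- Conventions. $\mathcal F f(\xi)=(2\pi)^{-n/2}\int_{\mathbb R^n} f(x)e^{-ix\cdot\xi}\,dx$, extended to tempered distributions; $n\ge1$; functions are complex valued; $|\cdot|$ is the Euclidean norm. A measurable $f:(0,\infty)\to(0,\infty)$ is regularly varying of index $\alpha\in\mathbb R$ if $f(tx)/f(t)\to x^\alpha$ as $t\to\infty$ for every $x>0$, and slowly varying if $\alpha=0$. Weights. $\mathcal W(\mathbb R)$ is the set of $w_*:[0,\infty)\to\mathbb R$ such that $w_*\in C^\infty(0,\infty)$ is regularly varying of some index in $[0,1)$; $w_*\ge1$; $w_*$ is strictly increasing; $w_*(t)-M\log t\to\infty$ as $t\to\infty$ for every $M\in\mathbb R$; $w_*'(0)=0$ (one-sided derivative); and there is $\tau$ with $w_*''(x)<0$ for all $x>\tau$. $\mathcal W_1(\mathbb R)$ is the set of $w_*\in\mathcal W(\mathbb R)$ that are regularly varying of index $\alpha\in(0,1)$; then $w_*(x)=x^\alpha\widetilde w_*(x)$ for $x>0$ with $\widetilde w_*$ slowly varying. Spaces. Fix a smooth window $\rho:\mathbb R^n\to[0,1]$ supported in $[-1,1]^n$ with $\rho=1$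 on $[-\frac12,\frac12]^n$; put $\sigma_k(\xi)=\rho(\xi-k)\big/\sum_{m\in\mathbb Z^n}\rho(\xi-m)$ and $\Box_kf=\mathcal F^{-1}(\sigma_k\mathcal Ff)$ for $k\in\mathbb Z^n$. For $1\le p,q\le\infty$ let $\mathcal M^{w_*}_{p,q}(\mathbb R^n)$ be the set of all $f\in L^p(\mathbb R^n)$ with $$\|f\|_{\mathcal M^{w_*}_{p,q}}=\Big(\sum_{k\in\mathbb Z^n}e^{q w_*(|k|)}\|\Box_kf\|_{L^p}^q\Big)^{1/q}<\infty$$ (supremum over $k$ if $q=\infty$). For $\epsilon\in\{0,1\}^n$ and $R>0$ let $P_R=\{\xi:|\xi_j|\le R,\ j=1,\dots,n\}$, $P_R(\epsilon)=\{\xi:\operatorname{sgn}\xi_j=(-1)^{\epsilon_j},\ j=1,\dots,n\}\setminus P_R$ and $$\mathcal M^{w_*}_{p,q}(\epsilon,R)=\{f\in\mathcal M^{w_*}_{p,q}(\mathbb R^n):\operatorname{supp}\mathcal F f\subset P_R(\epsilon)\}.$$ Proposition. Let $w_*\in\mathcal W_1(\mathbb R)$ with $w_*(x)=x^\alpha\widetilde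 w_*(x)$ as above. There is a number $s>0$, depending only on $w_*$, such that for some $\tilde x>0$ $$w_*(x)\le w_*(y)+w_*(x-y)-s\min(w_*(y),w_*(x-y))\qquad\text{whenever }x\ge2\tilde x,\ 0\le y\le x,$$ and such that for all $n\ge1$, every window $\rho$, all $1\le p,q\le\infty$, and $q'$ with $\frac1q+\frac1{q'}=1$, the following holds. $\mathcal M^{w_*}_{p,q}(\mathbb R^n)$ is an algebra under pointwise multiplication, and for all $\epsilon\in\{0,1\}^n$ and $R\ge2$ the set $\mathcal M^{w_*}_{p,q}(\epsilon,R)$ is a subalgebra of it. Moreover $$\|fg\|_{\mathcal M^{w_*}_{p,q}}\le D_R\,\|f\|_{\mathcal M^{w_*}_{p,q}}\|g\|_{\mathcal M^{w_*}_{p,q}}\qquad\text{for all }\epsilon\in\{0,1\}^n,\ R\ge2,\ f,g\in\mathcal M^{w_*}_{p,q}(\epsilon,R),$$ with $D_R$ as follows. (a) If $\liminf_{t\to\infty}\widetilde w_*(t)=C_0\in(0,\infty]$ and $c=\min(1,C_0)$, one may take $$D_R=C\Big(\int_{sq'c(R-2)^\alpha}^\infty y^{n/\alpha-1}e^{-y}\,dy\Big)^{1/q'},$$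 where $C>0$ depends only on $n,p,q,w_*$ and the window $\rho$. (b) If $\liminf_{t\to\infty}\widetilde w_*(t)=0$ and $\delta>0$ is such that $\alpha-\delta>0$, one may take $$D_R=C\Big(\int_{sq'(R-2)^{\alpha-\delta}}^\infty y^{n/\alpha-1}e^{-y}\,dy\Big)^{1/q'},$$ where $C>0$ depends only on $n,p,q,w_*$, the window $\rho$ and $\delta$. For $q=1$ (so $q'=\infty$) the expression $\big(\int_{q'b}^\infty y^{n/\alpha-1}e^{-y}\,dy\big)^{1/q'}$ is read as its limit $e^{-b}$. In both cases $D_R\to0$ as $R\to\infty$. -/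

import Mathlib

open MeasureTheory Filter Topology Set
open scoped ENNReal SchwartzMap ContDiff FourierTransform

noncomputable section

namespace UltraModulation

/-! ## Weight functions -/

/-- `f : (0, ∞) → (0, ∞)` is measurable and `f (t x) / f t → x ^ α` as `t → ∞`, for all `x > 0`.
Only the values of `f` on `(0, ∞)` matter. -/
structure IsRegularlyVarying (f : ℝ → ℝ) (α : ℝ) : Prop where
  measurable : Measurable ((Ioi (0 : ℝ)).domRestrict f)
  pos : ∀ x, 0 < x → 0 < f x
  tendsto : ∀ x, 0 < x → Tendsto (fun t => f (t * x) / f t) atTop (𝓝 (x ^ α))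

/-- Slowly varying functions: `f (t x) / f t → 1` as `t → ∞`, for all `x > 0`. -/
structure IsSlowlyVarying (f : ℝ → ℝ) : Prop where
  measurable : Measurable ((Ioi (0 : ℝ)).domRestrict f)
  pos : ∀ x, 0 < x → 0 < f x
  tendsto : ∀ x, 0 < x → Tendsto (fun t => f (t * x) / f t) atTop (𝓝 1)

/-- The class `𝒲(ℝ)` of admissible weights `w : [0, ∞) → ℝ`; only the values of `w` on `[0, ∞)`
matter. -/
structure IsAdmissibleWeight (w : ℝ → ℝ) : Prop where
  smooth : ContDiffOn ℝ ∞ w (Ioi 0)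
  regularlyVarying : ∃ α : ℝ, 0 ≤ α ∧ α < 1 ∧ IsRegularlyVarying w α
  one_le : ∀ x, 0 ≤ x → 1 ≤ w x
  strictMono : StrictMonoOn w (Ici 0)
  superlog : ∀ M : ℝ, Tendsto (fun t => w t - M * Real.log t) atTop atTop
  deriv_zero : HasDerivWithinAt w 0 (Ici 0) 0
  eventually_concave : ∃ τ : ℝ, 0 < τ ∧ ∀ x, τ < x → iteratedDeriv 2 w x < 0

/-- The class `𝒲₁(ℝ)`: admissible weights that are regularly varying of some index in `(0, 1)`. -/
structure IsAdmissibleWeightOne (w : ℝ → ℝ) : Prop where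
  admissible : IsAdmissibleWeight w
  index : ∃ α : ℝ, 0 < α ∧ α < 1 ∧ IsRegularlyVarying w α

/-! ## The frequency-uniform decomposition -/

/-- The window `ρ : ℝⁿ → [0, 1]`: smooth, supported in the cube `[-1, 1]ⁿ`, and equal to `1` on
`[-1/2, 1/2]ⁿ`. -/
structure IsWindow {n : ℕ} (ρ : EuclideanSpace ℝ (Fin n) → ℝ) : Prop where
  smooth : ContDiff ℝ ∞ ρ
  nonneg : ∀ ξ, 0 ≤ ρ ξ
  le_one : ∀ ξ, ρ ξ ≤ 1
  support : tsupport ρ ⊆ {ξ | ∀ i, |ξ i| ≤ 1}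
  eq_one : ∀ ξ : EuclideanSpace ℝ (Fin n), (∀ i, |ξ i| ≤ 1 / 2) → ρ ξ = 1

/-- The lattice point `k ∈ ℤⁿ` as a point of `ℝⁿ`. -/
def latticePoint {n : ℕ} (k : Fin n → ℤ) : EuclideanSpace ℝ (Fin n) :=
  WithLp.toLp 2 fun i => (k i : ℝ)

/-- `σ_k(ξ) = ρ(ξ - k) / ∑_m ρ(ξ - m)`. -/
def sigma {n : ℕ} (ρ : EuclideanSpace ℝ (Fin n) → ℝ) (k : Fin n → ℤ)
    (ξ : EuclideanSpace ℝ (Fin n)) : ℝ :=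
  ρ (ξ - latticePoint k) / ∑' m : Fin n → ℤ, ρ (ξ - latticePoint m)

/-- The uniform decomposition operator `□_k u = ℱ⁻¹(σ_k ℱ u)` on tempered distributions, where
`ℱ u(ξ) = (2π)^{-n/2} ∫ u(x) e^{-i x·ξ} dx`.  Mathlib's transform is
`𝓕 u(η) = ∫ u(x) e^{-2πi x·η} dx`, so `ℱ u(ξ) = (2π)^{-n/2} 𝓕 u(ξ / 2π)`: the frequency `ξ = 2πη`
belongs to Mathlib's variable `η`, and the multiplier is `η ↦ σ_k(2πη)`. -/
def box {n : ℕ} (ρ : EuclideanSpace ℝ (Fin n) → ℝ) (k : Fin n → ℤ)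
    (u : 𝓢'(EuclideanSpace ℝ (Fin n), ℂ)) : 𝓢'(EuclideanSpace ℝ (Fin n), ℂ) :=
  TemperedDistribution.fourierMultiplierCLM ℂ
    (fun η => ((sigma ρ k ((2 * Real.pi) • η) : ℝ) : ℂ)) u

/-- The support of `ℱ u`, in the frequency variable `ξ = 2πη`. -/
def fourierSupport {n : ℕ} (u : 𝓢'(EuclideanSpace ℝ (Fin n), ℂ)) :
    Set (EuclideanSpace ℝ (Fin n)) :=
  (fun η => (2 * Real.pi) • η) '' Distribution.dsupport
    (𝓕 u : 𝓢'(EuclideanSpace ℝ (Fin n), ℂ))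

/-- The `L^p` norm of a tempered distribution: the norm of the (unique) `L^p` function that
represents it, and `∞` if there is none. -/
def distLpNorm {n : ℕ} (p : ℝ≥0∞) [Fact (1 ≤ p)]
    (u : 𝓢'(EuclideanSpace ℝ (Fin n), ℂ)) : ℝ≥0∞ :=
  ⨅ (h : Lp ℂ p (volume : Measure (EuclideanSpace ℝ (Fin n))))
    (_ : Lp.toTemperedDistribution h = u), ‖h‖ₑ

/-! ## Weighted modulation spaces -/

/-- The `ℓ^q` norm of a family of extended nonnegative numbers. -/
def lqNorm {ι : Type*} (q : ℝ≥0∞) (a : ι → ℝ≥0∞) : ℝ≥0∞ :=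
  if q = ⊤ then ⨆ k, a k else (∑' k, a k ^ q.toReal) ^ (1 / q.toReal)

open scoped Classical in
/-- The norm `‖(e^{w(|k|)} ‖□_k f‖_{L^p})_k‖_{ℓ^q}` of `f ∈ L^p`; it is `∞` if `f ∉ L^p`. -/
def modulationNorm {n : ℕ} (ρ : EuclideanSpace ℝ (Fin n) → ℝ) (w : ℝ → ℝ) (p q : ℝ≥0∞)
    [Fact (1 ≤ p)] (f : EuclideanSpace ℝ (Fin n) →ₘ[volume] ℂ) : ℝ≥0∞ :=
  if hf : f ∈ Lp ℂ p volume then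
    lqNorm q fun k : Fin n → ℤ => ENNReal.ofReal (Real.exp (w ‖latticePoint k‖)) *
      distLpNorm p (box ρ k (Lp.toTemperedDistribution ⟨f, hf⟩))
  else ⊤

/-- The weighted modulation space `ℳ^w_{p,q}(ℝⁿ)`, a set of (classes of) functions in `L^p`. -/
def modulationSpace {n : ℕ} (ρ : EuclideanSpace ℝ (Fin n) → ℝ) (w : ℝ → ℝ) (p q : ℝ≥0∞)
    [Fact (1 ≤ p)] : Set (EuclideanSpace ℝ (Fin n) →ₘ[volume] ℂ) :=
  {f | f ∈ Lp ℂ p volume ∧ modulationNorm ρ w p q f < ⊤}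

/-- `S` is a set of (classes of) functions which is an algebra under the pointwise operations:
a complex linear space that is closed under pointwise multiplication. -/
def IsPointwiseAlgebra {n : ℕ} (S : Set (EuclideanSpace ℝ (Fin n) →ₘ[volume] ℂ)) : Prop :=
  (∃ V : Submodule ℂ (EuclideanSpace ℝ (Fin n) →ₘ[volume] ℂ), (V : Set _) = S) ∧
    ∀ f ∈ S, ∀ g ∈ S, f * g ∈ S

/-- The cube `P_R = {ξ : |ξ_j| ≤ R for all j}`. -/
def cube (n : ℕ) (R : ℝ) : Set (EuclideanSpace ℝ (Fin n)) :=
  {ξ | ∀ j, |ξ j| ≤ R}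

/-- `P_R(ε) = {ξ : sgn ξ_j = (-1)^{ε_j} for all j} \ P_R`. -/
def orthantOutsideCube {n : ℕ} (ε : Fin n → Fin 2) (R : ℝ) : Set (EuclideanSpace ℝ (Fin n)) :=
  {ξ | ∀ j, Real.sign (ξ j) = (-1) ^ (ε j : ℕ)} \ cube n R

/-- `ℳ^w_{p,q}(ε, R)`: the elements of `ℳ^w_{p,q}(ℝⁿ)` with `supp ℱ f ⊆ P_R(ε)`. -/
def modulationSpaceOrthant {n : ℕ} (ρ : EuclideanSpace ℝ (Fin n) → ℝ) (w : ℝ → ℝ) (p q : ℝ≥0∞)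
    [Fact (1 ≤ p)] (ε : Fin n → Fin 2) (R : ℝ) :
    Set (EuclideanSpace ℝ (Fin n) →ₘ[volume] ℂ) :=
  {f | f ∈ modulationSpace ρ w p q ∧ ∃ hf : f ∈ Lp ℂ p volume,
    fourierSupport (Lp.toTemperedDistribution ⟨f, hf⟩) ⊆ orthantOutsideCube ε R}

/-! ## The product constant -/

/-- `(∫_{q' b}^∞ y^{a-1} e^{-y} dy)^{1/q'}`, read for `q' = ∞` as its limit `e^{-b}`. -/
def gammaTail (a : ℝ) (q' : ℝ≥0∞) (b : ℝ) : ℝ :=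
  if q' = ⊤ then Real.exp (-b)
  else (∫ y in Ioi (q'.toReal * b), y ^ (a - 1) * Real.exp (-y)) ^ (1 / q'.toReal)

end UltraModulation

end

namespace UltraModulation

/-! ## Growth and subadditivity of the weights -/

/-! The engine is a gain in the subadditivity of the weight. With index α < 1 one has w(2t) ≤ λ w(t)
for large t, where λ = 2^((1+α)/2) < 2. Eventual concavity gives w(x) - w(x-z) ≤ w(2z) - w(z) ≤
(λ-1) w(z) for large z ≤ x/2. Hence w(x) ≤ w(y) + w(x-y) - s min(w(y), w(x-y)) for some s > 0
(`exists_strong_subadditive`).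

Expand f and g into their pieces □_j f and □_l g. The piece □_k (□_j f · □_l g) vanishes unless k -
j - l lies in a fixed finite box. A Bernstein inequality (`exists_enorm_boxTop_le`) bounds □_l g in
L^∞ by its L^p norm, so the L^p norm of □_k(fg) is at most a convolution-type sum of the L^p norms
of the pieces (`exists_enorm_box_product_le`). For the surviving triples, e^{w(|k|)} ≤ C e^{w(|j|)}
e^{w(|l|)} (e^{-s w(|j|)} + e^{-s w(|l|)}), so in each summand one of the two weighted sequences
carries an extra factor e^{-sw}. Hölder puts that sequence in ℓ¹ at the price of the ℓ^{q'} norm of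
e^{-sw}, finite because w outgrows every multiple of log; Young's inequality does the rest
(`lqNorm_weighted_convolution_le`). This is the algebra property.

If both spectra lie outside P_R, only frequencies |j| ≥ R-2 occur. Half of the exponent in e^{-sw}
pays for the sum over the lattice, the other half leaves e^{-(s/2) w(R-2)}. This is compared with
the incomplete Gamma function by elementary bounds: w(x) ≥ (c/2) x^α - K, respectively w(x) ≥
x^{α-δ} - K, and the Gamma tail at b is at least e^{-1} e^{-b} because n/α ≥ 1.

The spectrum of fg lies in the sum of the two spectra whenever that sum is closed
(`dsupport_product_subset`). Inside an orthant coordinates cannot cancel, which makes the sum closed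
and keeps it outside P_R; hence the subalgebras. -/

theorem IsAdmissibleWeightOne.isRegularlyVarying {w wt : ℝ → ℝ} {α : ℝ}
    (hw : IsAdmissibleWeightOne w) (hwt : IsSlowlyVarying wt)
    (hrep : ∀ x : ℝ, 0 < x → w x = x ^ α * wt x) :
    0 < α ∧ α < 1 ∧ IsRegularlyVarying w α := by
  obtain ⟨β, hβ0, hβ1, hβ⟩ := hw.index
  have key : ∀ x : ℝ, 0 < x → Tendsto (fun t => w (t * x) / w t) atTop (𝓝 (x ^ α)) := by
    intro x hx
    have h := (hwt.tendsto x hx).const_mul (x ^ α)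
    rw [mul_one] at h
    refine h.congr' ?_
    filter_upwards [eventually_gt_atTop 0] with t ht
    rw [hrep t ht, hrep (t * x) (by positivity), Real.mul_rpow ht.le hx.le]
    have h1 := hwt.pos t ht
    have h2 := Real.rpow_pos_of_pos ht α
    field_simp
  -- The exponent of the representation and the index supplied by the class both describe the limit
  -- of w(2t)/w(t), so they agree; the bounds 0 < α < 1 come from the latter.
  have h2 : (2 : ℝ) ^ α = 2 ^ β :=
    tendsto_nhds_unique (key 2 (by norm_num)) (hβ.tendsto 2 (by norm_num))
  have : α = β := (Real.rpow_right_inj (by norm_num) (by norm_num)).1 h2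
  subst this
  exact ⟨hβ0, hβ1, hβ⟩

section Weight

variable {w : ℝ → ℝ}

theorem IsAdmissibleWeight.mono (hw : IsAdmissibleWeight w) {x y : ℝ} (hx : 0 ≤ x) (hxy : x ≤ y) :
    w x ≤ w y :=
  hw.strictMono.monotoneOn hx (hx.trans hxy : (0 : ℝ) ≤ y) hxy

theorem IsAdmissibleWeight.pos (hw : IsAdmissibleWeight w) {x : ℝ} (hx : 0 ≤ x) : 0 < w x :=
  one_pos.trans_le (hw.one_le x hx)

theorem exists_dyadic_near {x t₀ : ℝ} (ht₀ : 0 < t₀) (hx : t₀ ≤ x) :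
    ∃ N : ℕ, 2 ^ N * t₀ ≤ x ∧ x < 2 ^ (N + 1) * t₀ := by
  obtain ⟨N, h1, h2⟩ := exists_nat_pow_near (x := x / t₀) (y := 2) (by rwa [one_le_div ht₀])
    (by norm_num)
  exact ⟨N, by rwa [le_div_iff₀ ht₀] at h1, by rwa [div_lt_iff₀ ht₀] at h2⟩

/-- The doubling inequality is iterated along the points 2^N t₀, and monotonicity fills the dyadic
gaps. Together with its mirror image below, this is the part of Potter's bounds that is needed. -/
theorem IsAdmissibleWeight.le_mul_rpow (hw : IsAdmissibleWeight w) {β t₀ : ℝ} (hβ : 0 ≤ β)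
    (ht₀ : 0 < t₀) (h : ∀ t, t₀ ≤ t → w (t * 2) ≤ 2 ^ β * w t) :
    ∃ C : ℝ, 0 < C ∧ ∀ x, t₀ ≤ x → w x ≤ C * x ^ β := by
  have hN : ∀ N : ℕ, w (2 ^ N * t₀) ≤ (2 ^ N : ℝ) ^ β * w t₀ := by
    intro N
    induction N with
    | zero => simp
    | succ N ih =>
      have h1 := h (2 ^ N * t₀) (le_mul_of_one_le_left ht₀.le (one_le_pow₀ (by norm_num)))
      have : (2 : ℝ) ^ (N + 1) * t₀ = 2 ^ N * t₀ * 2 := by ring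
      rw [this, pow_succ, Real.mul_rpow (by positivity) (by norm_num)]
      have h2 := mul_le_mul_of_nonneg_left ih (Real.rpow_nonneg (by norm_num : (0 : ℝ) ≤ 2) β)
      linarith
  have hw0 := hw.pos ht₀.le
  refine ⟨(2 / t₀) ^ β * w t₀, by positivity, fun x hx => ?_⟩
  obtain ⟨N, h1, h2⟩ := exists_dyadic_near ht₀ hx
  have hx0 : 0 < x := ht₀.trans_le hx
  calc w x ≤ w (2 ^ (N + 1) * t₀) := hw.mono hx0.le h2.le
    _ ≤ (2 ^ (N + 1) : ℝ) ^ β * w t₀ := hN _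
    _ ≤ (2 / t₀ * x) ^ β * w t₀ := by
        gcongr
        rw [div_mul_eq_mul_div, le_div_iff₀ ht₀, pow_succ]
        nlinarith
    _ = (2 / t₀) ^ β * w t₀ * x ^ β := by
        rw [Real.mul_rpow (by positivity) hx0.le]; ring

theorem IsAdmissibleWeight.mul_rpow_le (hw : IsAdmissibleWeight w) {β t₀ : ℝ} (hβ : 0 ≤ β)
    (ht₀ : 0 < t₀) (h : ∀ t, t₀ ≤ t → 2 ^ β * w t ≤ w (t * 2)) :
    ∃ C : ℝ, 0 < C ∧ ∀ x, t₀ ≤ x → C * x ^ β ≤ w x := by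
  have hN : ∀ N : ℕ, (2 ^ N : ℝ) ^ β * w t₀ ≤ w (2 ^ N * t₀) := by
    intro N
    induction N with
    | zero => simp
    | succ N ih =>
      have h1 := h (2 ^ N * t₀) (le_mul_of_one_le_left ht₀.le (one_le_pow₀ (by norm_num)))
      have : (2 : ℝ) ^ (N + 1) * t₀ = 2 ^ N * t₀ * 2 := by ring
      rw [this, pow_succ, Real.mul_rpow (by positivity) (by norm_num)]
      have h2 := mul_le_mul_of_nonneg_left ih (Real.rpow_nonneg (by norm_num : (0 : ℝ) ≤ 2) β)
      linarith
  have hw0 := hw.pos ht₀.le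
  refine ⟨(1 / (2 * t₀)) ^ β * w t₀, by positivity, fun x hx => ?_⟩
  obtain ⟨N, h1, h2⟩ := exists_dyadic_near ht₀ hx
  have hx0 : 0 < x := ht₀.trans_le hx
  calc (1 / (2 * t₀)) ^ β * w t₀ * x ^ β = (1 / (2 * t₀) * x) ^ β * w t₀ := by
        rw [Real.mul_rpow (by positivity) hx0.le]; ring
    _ ≤ (2 ^ N : ℝ) ^ β * w t₀ := by
        gcongr
        rw [div_mul_eq_mul_div, div_le_iff₀ (by positivity)]
        rw [pow_succ] at h2
        nlinarith
    _ ≤ w (2 ^ N * t₀) := hN _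
    _ ≤ w x := hw.mono (by positivity) h1

theorem IsAdmissibleWeight.exists_concaveOn (hw : IsAdmissibleWeight w) :
    ∃ τ : ℝ, 0 < τ ∧ ConcaveOn ℝ (Ioi τ) w := by
  obtain ⟨τ, hτ0, hτ⟩ := hw.eventually_concave
  have hs : ContDiffOn ℝ ∞ w (Ioi τ) := hw.smooth.mono (Ioi_subset_Ioi hτ0.le)
  have hd : DifferentiableOn ℝ w (Ioi τ) := hs.differentiableOn (by norm_num)
  refine ⟨τ, hτ0, concaveOn_of_deriv2_nonpos (convex_Ioi τ) hs.continuousOn ?_ ?_ ?_⟩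
  · rwa [interior_Ioi]
  · rw [interior_Ioi]
    exact (hs.deriv_of_isOpen (m := 1) isOpen_Ioi (by norm_cast)).differentiableOn (by norm_num)
  · intro x hx
    rw [interior_Ioi] at hx
    have := hτ x hx
    rw [iteratedDeriv_eq_iterate] at this
    exact this.le

/-- The points a + d and b are convex combinations of the endpoints a and b + d with interchanged
coefficients; the two concavity inequalities are added. -/
theorem concaveOn_add_sub_le_add_sub {τ : ℝ} (h : ConcaveOn ℝ (Ioi τ) w) {a b d : ℝ}
    (ha : τ < a) (hab : a ≤ b) (hd : 0 ≤ d) : w (b + d) - w b ≤ w (a + d) - w a := by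
  rcases hd.eq_or_lt with rfl | hd
  · simp
  have hL : 0 < b - a + d := by linarith
  have hb' : τ < b + d := by linarith
  have hs : (b - a) / (b - a + d) + d / (b - a + d) = 1 := by field_simp
  have hl1 : 0 ≤ (b - a) / (b - a + d) := div_nonneg (by linarith) hL.le
  have hl2 : 0 ≤ d / (b - a + d) := by positivity
  have e1 := h.2 ha hb' hl1 hl2 hs
  have e2 := h.2 ha hb' hl2 hl1 (by rw [add_comm, hs])
  have p1 : ((b - a) / (b - a + d)) • a + (d / (b - a + d)) • (b + d) = a + d := by
    simp only [smul_eq_mul]; field_simp; ring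
  have p2 : (d / (b - a + d)) • a + ((b - a) / (b - a + d)) • (b + d) = b := by
    simp only [smul_eq_mul]; field_simp; ring
  rw [p1] at e1
  rw [p2] at e2
  simp only [smul_eq_mul] at e1 e2
  have : (b - a) / (b - a + d) * w a + d / (b - a + d) * w (b + d) +
      (d / (b - a + d) * w a + (b - a) / (b - a + d) * w (b + d)) = w a + w (b + d) := by
    linear_combination (w a + w (b + d)) * hs
  linarith

theorem IsAdmissibleWeight.exists_doubling_le (hw : IsAdmissibleWeight w) {α β : ℝ}
    (h : IsRegularlyVarying w α) (hαβ : α < β) :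
    ∃ t₀ : ℝ, 0 < t₀ ∧ ∀ t, t₀ ≤ t → w (t * 2) ≤ 2 ^ β * w t := by
  have h1 := (h.tendsto 2 (by norm_num)).eventually_lt_const
    (Real.rpow_lt_rpow_of_exponent_lt (by norm_num : (1 : ℝ) < 2) hαβ)
  obtain ⟨t₀, ht₀⟩ := eventually_atTop.1 h1
  refine ⟨max t₀ 1, by positivity, fun t ht => ?_⟩
  have htp : 0 < t := lt_of_lt_of_le (by positivity) ht
  have := ht₀ t ((le_max_left _ _).trans ht)
  rw [div_lt_iff₀ (hw.pos htp.le)] at this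
  exact this.le

theorem IsAdmissibleWeight.exists_le_doubling (hw : IsAdmissibleWeight w) {α β : ℝ}
    (h : IsRegularlyVarying w α) (hαβ : β < α) :
    ∃ t₀ : ℝ, 0 < t₀ ∧ ∀ t, t₀ ≤ t → 2 ^ β * w t ≤ w (t * 2) := by
  have h1 := (h.tendsto 2 (by norm_num)).eventually_const_lt
    (Real.rpow_lt_rpow_of_exponent_lt (by norm_num : (1 : ℝ) < 2) hαβ)
  obtain ⟨t₀, ht₀⟩ := eventually_atTop.1 h1
  refine ⟨max t₀ 1, by positivity, fun t ht => ?_⟩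
  have htp : 0 < t := lt_of_lt_of_le (by positivity) ht
  have := ht₀ t ((le_max_left _ _).trans ht)
  rw [lt_div_iff₀ (hw.pos htp.le)] at this
  exact this.le

/-- By concavity the slope of w on [x-a, x] is at most its slope on [τ+1, x-a], which is of order
x^{-(1-α)/2} since w grows at most like x^{(1+α)/2}. Increments of fixed length therefore tend to 0.
-/
theorem IsAdmissibleWeight.exists_sub_le (hw : IsAdmissibleWeight w) {α : ℝ} (hα0 : 0 ≤ α)
    (hα1 : α < 1) (h : IsRegularlyVarying w α) {a ε : ℝ} (ha : 0 < a) (hε : 0 < ε) :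
    ∃ X : ℝ, a ≤ X ∧ ∀ x, X ≤ x → w x - w (x - a) ≤ ε := by
  obtain ⟨τ, hτ0, hτ⟩ := hw.exists_concaveOn
  obtain ⟨t₀, ht₀, hd⟩ := hw.exists_doubling_le h (β := (1 + α) / 2) (by linarith)
  obtain ⟨C, hC, hup⟩ := hw.le_mul_rpow (by linarith) ht₀ hd
  have hlim : Tendsto (fun x : ℝ => 2 * a * C * x ^ (-((1 - α) / 2))) atTop (𝓝 0) := by
    simpa using (tendsto_rpow_neg_atTop (by linarith : 0 < (1 - α) / 2)).const_mul (2 * a * C)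
  obtain ⟨X, hX⟩ := eventually_atTop.1 (hlim.eventually_lt_const hε)
  refine ⟨max (max X t₀) (2 * (a + τ + 1)), ?_, fun x hx => ?_⟩
  · exact le_max_of_le_right (by linarith)
  have hxX : X ≤ x := (le_max_left _ _).trans ((le_max_left _ _).trans hx)
  have hxt : t₀ ≤ x := (le_max_right _ _).trans ((le_max_left _ _).trans hx)
  have hxa : 2 * (a + τ + 1) ≤ x := (le_max_right _ _).trans hx
  have hx0 : 0 < x := ht₀.trans_le hxt
  have hsl := hτ.slope_anti_adjacent (x := τ + 1) (y := x - a) (z := x)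
    (by simp) (by simp only [mem_Ioi]; linarith) (by linarith) (by linarith)
  have hden : 0 < x - a - (τ + 1) := by linarith
  rw [sub_sub_cancel, div_le_div_iff₀ ha hden] at hsl
  have h1 : w (x - a) ≤ C * x ^ ((1 + α) / 2) := (hw.mono (by linarith) (by linarith)).trans (hup x hxt)
  have h2 : 0 < w (τ + 1) := hw.pos (by linarith)
  have h0 : 0 ≤ w x - w (x - a) := sub_nonneg.2 (hw.mono (by linarith) (by linarith))
  have h3 : (w x - w (x - a)) * x ≤ 2 * a * C * x ^ ((1 + α) / 2) := by
    nlinarith [mul_le_mul_of_nonneg_left (by linarith : x ≤ 2 * (x - a - (τ + 1))) h0]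
  have h4 : x ^ ((1 + α) / 2) = x ^ (-((1 - α) / 2)) * x := by
    rw [← Real.rpow_add_one hx0.ne']; congr 1; ring
  have h5 := hX x hxX
  rw [h4, ← mul_assoc] at h3
  exact (le_of_mul_le_mul_right h3 hx0).trans h5.le

theorem IsAdmissibleWeight.exists_add_le (hw : IsAdmissibleWeight w) {α : ℝ} (hα0 : 0 ≤ α)
    (hα1 : α < 1) (h : IsRegularlyVarying w α) {a : ℝ} (ha : 0 < a) :
    ∃ C : ℝ, 0 ≤ C ∧ ∀ x, 0 ≤ x → w (x + a) ≤ w x + C := by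
  obtain ⟨X, haX, hX⟩ := hw.exists_sub_le hα0 hα1 h ha one_pos
  have hX0 : 0 ≤ X := ha.le.trans haX
  refine ⟨w X, (hw.pos hX0).le, fun x hx => ?_⟩
  rcases le_total X (x + a) with h1 | h1
  · have := hX (x + a) h1
    rw [add_sub_cancel_right] at this
    linarith [hw.one_le X hX0]
  · linarith [hw.mono (by linarith : 0 ≤ x + a) h1, hw.pos hx]

theorem IsAdmissibleWeight.exists_strong_subadditive (hw : IsAdmissibleWeight w) {α : ℝ}
    (hα0 : 0 ≤ α) (hα1 : α < 1) (h : IsRegularlyVarying w α) :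
    ∃ s : ℝ, 0 < s ∧ s ≤ 1 ∧ ∃ x₁ : ℝ, 0 < x₁ ∧ ∀ x y : ℝ, 2 * x₁ ≤ x → 0 ≤ y → y ≤ x →
      w x ≤ w y + w (x - y) - s * min (w y) (w (x - y)) := by
  obtain ⟨τ, hτ0, hτ⟩ := hw.exists_concaveOn
  obtain ⟨t₀, ht₀, hd⟩ := hw.exists_doubling_le h (β := (1 + α) / 2) (by linarith)
  have hβ : (2 : ℝ) ^ ((1 + α) / 2) < 2 := by
    simpa using Real.rpow_lt_rpow_of_exponent_lt (by norm_num : (1 : ℝ) < 2)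
      (by linarith : (1 + α) / 2 < 1)
  set β := (2 : ℝ) ^ ((1 + α) / 2) with hβdef
  set y₀ := t₀ + τ with hy₀
  obtain ⟨X, hyX, hX⟩ := hw.exists_sub_le hα0 hα1 h (a := y₀) (ε := 1 / 2) (by linarith)
    (by norm_num)
  -- The bound 2 - β serves large z, where the increment of w over [x-z, x] is at most (β-1) w(z).
  -- The bound 1/2 serves z ≤ y₀, where that increment is at most 1/2 for large x, hence at most
  -- (1-s) w(z) because w ≥ 1.
  set s := min (1 / 2) (2 - β) with hs
  have hs1 : s ≤ 1 / 2 := min_le_left _ _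
  have hs2 : s ≤ 2 - β := min_le_right _ _
  have hs0 : 0 < s := lt_min (by norm_num) (by linarith)
  have key : ∀ x z : ℝ, X ≤ x → 0 ≤ z → 2 * z ≤ x → w x ≤ w z + w (x - z) - s * w z := by
    intro x z hx hz hzx
    rcases le_total y₀ z with h1 | h1
    · have h2 := concaveOn_add_sub_le_add_sub hτ (a := z) (b := x - z) (d := z) (by linarith) (by linarith) hz
      rw [sub_add_cancel, ← mul_two] at h2
      have h3 := hd z (by linarith)
      nlinarith [mul_le_mul_of_nonneg_right hs2 (hw.pos hz).le]
    · have h2 := hX x hx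
      have h3 := hw.mono (x := x - y₀) (y := x - z) (by linarith) (by linarith)
      nlinarith [hw.one_le z hz]
  refine ⟨s, hs0, by linarith, X, by linarith, fun x y hx hy hyx => ?_⟩
  have hxX : X ≤ x := by linarith
  rcases le_total (2 * y) x with h1 | h1
  · rw [min_eq_left (hw.mono hy (by linarith))]
    exact key x y hxX hy h1
  · rw [min_eq_right (hw.mono (by linarith) (by linarith))]
    have := key x (x - y) hxX (by linarith) (by linarith)
    rw [sub_sub_cancel] at this
    linarith

/-- Interacting lattice frequencies satisfy k = j + l only up to a bounded error, and strong
subadditivity holds only for large arguments. Both defects go into the additive constant; for small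
x + y the condition s ≤ 1 keeps the subtracted term below w(x). -/
theorem IsAdmissibleWeight.exists_le_add_sub_min (hw : IsAdmissibleWeight w) {α s x₁ : ℝ}
    (hα0 : 0 ≤ α) (hα1 : α < 1) (h : IsRegularlyVarying w α) (hs1 : s ≤ 1)
    (hx₁ : 0 < x₁) (hsub : ∀ x y : ℝ, 2 * x₁ ≤ x → 0 ≤ y → y ≤ x →
      w x ≤ w y + w (x - y) - s * min (w y) (w (x - y))) {a : ℝ} (ha : 0 < a) :
    ∃ C : ℝ, 0 ≤ C ∧ ∀ x y z : ℝ, 0 ≤ x → 0 ≤ y → 0 ≤ z → z ≤ x + y + a →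
      w z ≤ w x + w y - s * min (w x) (w y) + C := by
  obtain ⟨C, hC0, hC⟩ := hw.exists_add_le hα0 hα1 h ha
  have hX0 : 0 ≤ w (2 * x₁) := (hw.pos (by linarith)).le
  refine ⟨C + w (2 * x₁), by linarith, fun x y z hx hy hz hzxy => ?_⟩
  have h1 := hw.mono hz hzxy
  have h2 := hC (x + y) (by linarith)
  rcases le_total (2 * x₁) (x + y) with h3 | h3
  · have h4 := hsub (x + y) x h3 hx (by linarith)
    rw [add_sub_cancel_left] at h4
    linarith
  · have h4 := hw.mono (by linarith) h3
    have h5 : s * min (w x) (w y) ≤ w x := by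
      have := mul_le_mul hs1 (min_le_left (w x) (w y))
        (le_min (hw.pos hx).le (hw.pos hy).le) zero_le_one
      linarith
    linarith [hw.pos hy]

theorem IsAdmissibleWeight.exists_mul_rpow_le (hw : IsAdmissibleWeight w) {wt : ℝ → ℝ} {α : ℝ}
    (hα0 : 0 < α) (hrep : ∀ x : ℝ, 0 < x → w x = x ^ α * wt x)
    {C₀ : ℝ≥0∞} (hC₀ : 0 < C₀)
    (hlim : liminf (fun t : ℝ => ENNReal.ofReal (wt t)) atTop = C₀) :
    ∃ K : ℝ, ∀ x, 0 ≤ x → (min 1 C₀).toReal / 2 * x ^ α ≤ w x + K := by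
  have hm0 : min 1 C₀ ≠ 0 := (lt_min one_pos hC₀).ne'
  have hmt : min 1 C₀ ≠ ⊤ := ((min_le_left _ _).trans_lt ENNReal.one_lt_top).ne
  -- Halving gives the strict inequality that makes the bound hold eventually, and the minimum with
  -- 1 covers C₀ = ∞. The factor 1/2 is recovered at the end by shrinking s.
  have hlt : min 1 C₀ / 2 < liminf (fun t : ℝ => ENNReal.ofReal (wt t)) atTop := by
    rw [hlim]
    exact (ENNReal.half_lt_self hm0 hmt).trans_le (min_le_right _ _)
  obtain ⟨T, hT⟩ := eventually_atTop.1 (eventually_lt_of_lt_liminf hlt)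
  have hT0 : 0 ≤ max T 1 := by positivity
  refine ⟨(min 1 C₀).toReal / 2 * (max T 1) ^ α, fun x hx => ?_⟩
  rcases le_total (max T 1) x with h1 | h1
  · have hx0 : 0 < x := by linarith [le_max_right T 1]
    have h2 := hT x ((le_max_left _ _).trans h1)
    have h3 := (ENNReal.lt_ofReal_iff_toReal_lt (ENNReal.div_ne_top hmt (by norm_num))).1 h2
    rw [ENNReal.toReal_div, ENNReal.toReal_ofNat] at h3
    rw [hrep x hx0, mul_comm (x ^ α)]
    have : 0 ≤ (min 1 C₀).toReal / 2 * (max T 1) ^ α := by positivity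
    have := mul_le_mul_of_nonneg_right h3.le (Real.rpow_nonneg hx α)
    linarith
  · have : (min 1 C₀).toReal / 2 * x ^ α ≤ (min 1 C₀).toReal / 2 * (max T 1) ^ α := by gcongr
    linarith [hw.pos hx]

theorem IsAdmissibleWeight.exists_rpow_le (hw : IsAdmissibleWeight w) {α δ : ℝ}
    (h : IsRegularlyVarying w α) (hδ : 0 < δ) (hδα : 0 < α - δ) :
    ∃ K : ℝ, ∀ x, 0 ≤ x → x ^ (α - δ) ≤ w x + K := by
  -- Only half of δ is spent on the power bound; the spare factor x^{δ/2} eventually beats the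
  -- unknown constant, so that x^{α-δ} appears with coefficient 1.
  obtain ⟨t₀, ht₀, hd⟩ := hw.exists_le_doubling h (β := α - δ / 2) (by linarith)
  obtain ⟨C, hC, hup⟩ := hw.mul_rpow_le (by linarith) ht₀ hd
  obtain ⟨T, hT⟩ := eventually_atTop.1
    ((tendsto_rpow_atTop (by linarith : 0 < δ / 2)).eventually_ge_atTop (1 / C))
  have hTp : 0 < max T t₀ := lt_max_of_lt_right ht₀
  refine ⟨(max T t₀) ^ (α - δ), fun x hx => ?_⟩
  rcases le_total (max T t₀) x with h1 | h1
  · have hx0 : 0 < x := hTp.trans_le h1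
    have h2 := hup x ((le_max_right _ _).trans h1)
    have h3 := hT x ((le_max_left _ _).trans h1)
    rw [div_le_iff₀ hC] at h3
    have h4 : x ^ (α - δ / 2) = x ^ (α - δ) * x ^ (δ / 2) := by
      rw [← Real.rpow_add hx0]; congr 1; ring
    have h5 : 0 ≤ (max T t₀) ^ (α - δ) := by positivity
    have h6 := mul_le_mul_of_nonneg_left h3 (Real.rpow_nonneg hx (α - δ))
    rw [h4] at h2
    linarith
  · have := Real.rpow_le_rpow hx h1 hδα.le
    linarith [hw.pos hx]

end Weight

/-! ## Lattice sums -/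

theorem ENNReal_tsum_pi_prod (f : ℤ → ℝ≥0∞) (n : ℕ) :
    ∑' k : Fin n → ℤ, ∏ i, f (k i) = (∑' a, f a) ^ n := by
  induction n with
  | zero => simp
  | succ n ih =>
    rw [← (Fin.consEquiv fun _ => ℤ).tsum_eq, ENNReal.tsum_prod']
    simp only [Fin.consEquiv_apply, Fin.prod_univ_succ, Fin.cons_zero, Fin.cons_succ,
      ENNReal.tsum_mul_left, ih, ENNReal.tsum_mul_right]
    rw [pow_succ, mul_comm]

theorem abs_le_norm_latticePoint {n : ℕ} (k : Fin n → ℤ) (i : Fin n) :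
    |(k i : ℝ)| ≤ ‖latticePoint k‖ := by
  have := PiLp.norm_apply_le (latticePoint k) i
  simpa [latticePoint] using this

/-- Superlogarithmic growth gives r w(t) ≥ 2n log(1+t) - K. Since |k_i| ≤ |k|, the summand is
dominated by e^K ∏ (1+|k_i|)^{-2}, whose sum factorises. -/
theorem IsAdmissibleWeight.tsum_exp_neg_ne_top {w : ℝ → ℝ} (hw : IsAdmissibleWeight w) (n : ℕ)
    {r : ℝ} (hr : 0 < r) :
    ∑' k : Fin n → ℤ, ENNReal.ofReal (Real.exp (-(r * w ‖latticePoint k‖))) ≠ ⊤ := by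
  obtain ⟨K, hK⟩ : ∃ K : ℝ, ∀ t, 0 ≤ t → 2 * n * Real.log (1 + t) ≤ r * w t + K := by
    obtain ⟨T, hT⟩ := eventually_atTop.1
      ((hw.superlog (2 * n / r)).eventually_ge_atTop 0)
    have hT1 : 1 ≤ max T 1 := le_max_right _ _
    refine ⟨2 * n * Real.log (1 + max T 1) + 2 * n * Real.log 2, fun t ht => ?_⟩
    have hl0 : 0 ≤ Real.log (1 + max T 1) := Real.log_nonneg (by linarith)
    have hl2 : 0 ≤ Real.log 2 := Real.log_nonneg (by norm_num)
    rcases le_total (max T 1) t with h1 | h1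
    · have h2 := hT t ((le_max_left _ _).trans h1)
      have h3 : Real.log (1 + t) ≤ Real.log 2 + Real.log t := by
        rw [← Real.log_mul (by norm_num) (by linarith)]
        exact Real.log_le_log (by linarith) (by linarith)
      have h4 : 2 * n * Real.log t ≤ r * w t := by
        have := mul_le_mul_of_nonneg_left (sub_nonneg.1 h2) hr.le
        have e : r * (2 * n / r * Real.log t) = 2 * n * Real.log t := by field_simp
        linarith
      have h5 := mul_le_mul_of_nonneg_left h3 (by positivity : (0 : ℝ) ≤ 2 * n)
      have h6 : 0 ≤ 2 * n * Real.log (1 + max T 1) := by positivity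
      linarith
    · have h2 : Real.log (1 + t) ≤ Real.log (1 + max T 1) :=
        Real.log_le_log (by linarith) (by linarith)
      have h3 := mul_le_mul_of_nonneg_left h2 (by positivity : (0 : ℝ) ≤ 2 * n)
      have h4 : 0 ≤ r * w t := mul_nonneg hr.le (hw.pos ht).le
      have h5 : 0 ≤ 2 * n * Real.log 2 := by positivity
      linarith
  have hbound : ∀ k : Fin n → ℤ, ENNReal.ofReal (Real.exp (-(r * w ‖latticePoint k‖))) ≤
      ENNReal.ofReal (Real.exp K) * ∏ i, ENNReal.ofReal (((1 + |(k i : ℝ)|) ^ 2)⁻¹) := by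
    intro k
    rw [← ENNReal.ofReal_prod_of_nonneg (fun i _ => by positivity),
      ← ENNReal.ofReal_mul (by positivity)]
    refine ENNReal.ofReal_le_ofReal ?_
    have h1 : ∏ i, ((1 + |(k i : ℝ)|) ^ 2)⁻¹ =
        Real.exp (-(∑ i, 2 * Real.log (1 + |(k i : ℝ)|))) := by
      rw [← Finset.sum_neg_distrib, Real.exp_sum]
      refine Finset.prod_congr rfl fun i _ => ?_
      rw [Real.exp_neg, mul_comm, Real.exp_mul, Real.exp_log (by positivity)]
      norm_num
    rw [h1, ← Real.exp_add]
    refine Real.exp_le_exp.2 ?_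
    have h2 : ∑ i, 2 * Real.log (1 + |(k i : ℝ)|) ≤ 2 * n * Real.log (1 + ‖latticePoint k‖) := by
      calc ∑ i, 2 * Real.log (1 + |(k i : ℝ)|)
          ≤ ∑ _i : Fin n, 2 * Real.log (1 + ‖latticePoint k‖) := by
            refine Finset.sum_le_sum fun i _ => ?_
            have := Real.log_le_log (by positivity)
              (add_le_add_right (abs_le_norm_latticePoint k i) 1)
            linarith
        _ = _ := by simp; ring
    linarith [hK _ (norm_nonneg (latticePoint k))]
  refine ne_top_of_le_ne_top ?_ (ENNReal.tsum_le_tsum hbound)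
  rw [ENNReal.tsum_mul_left, ENNReal_tsum_pi_prod (fun a => ENNReal.ofReal (((1 + |(a : ℝ)|) ^ 2)⁻¹))]
  refine ENNReal.mul_ne_top ENNReal.ofReal_ne_top (ENNReal.pow_ne_top ?_)
  refine Summable.tsum_ofReal_ne_top ?_
  have h : Summable fun a : ℕ => ((1 + (a : ℝ)) ^ 2)⁻¹ := by
    have := (summable_nat_add_iff 1).2 (Real.summable_nat_pow_inv.2 (by norm_num : 1 < 2))
    simpa [add_comm] using this
  exact Summable.of_nat_of_neg (by simpa using h) (by simpa using h)

/-! ## Young's and Hölder's inequalities for functions with values in `[0, ∞]` -/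

section Young

variable {G : Type*} [AddCommGroup G] [MeasurableSpace G] {μ : Measure G}

/-- Hölder's inequality for the splitting K F = K^{1/r'} · (K^{1/r} F); this is Jensen's inequality
for the measure K dν, without normalisation. -/
theorem lintegral_mul_rpow_le {X : Type*} [MeasurableSpace X] {ν : Measure X} {K F : X → ℝ≥0∞}
    (hK : Measurable K) (hF : Measurable F) {r : ℝ} (hr : 1 ≤ r) :
    (∫⁻ y, K y * F y ∂ν) ^ r ≤ (∫⁻ y, K y ∂ν) ^ (r - 1) * ∫⁻ y, K y * F y ^ r ∂ν := by
  rcases hr.eq_or_lt with rfl | hr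
  · simp
  have hr0 : 0 < r := by linarith
  have hc : (Real.conjExponent r).HolderConjugate r := (Real.HolderConjugate.conjExponent hr).symm
  set r' := Real.conjExponent r with hr'
  have hr'0 : 0 < r' := hc.pos
  have hsum : 1 / r' + 1 / r = 1 := by simpa [one_div] using hc.inv_add_inv_eq_one
  have h := ENNReal.lintegral_mul_le_Lp_mul_Lq ν hc (f := fun y => K y ^ (1 / r'))
    (g := fun y => K y ^ (1 / r) * F y) (by fun_prop) (by fun_prop)
  have e1 : ∀ y, ((fun y => K y ^ (1 / r')) * fun y => K y ^ (1 / r) * F y) y = K y * F y := by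
    intro y
    simp only [Pi.mul_apply]
    rw [← mul_assoc, ← ENNReal.rpow_add_of_nonneg _ _ (by positivity) (by positivity), hsum,
      ENNReal.rpow_one]
  have e2 : ∀ y, (K y ^ (1 / r')) ^ r' = K y := by
    intro y
    rw [← ENNReal.rpow_mul, one_div_mul_cancel hr'0.ne', ENNReal.rpow_one]
  have e3 : ∀ y, (K y ^ (1 / r) * F y) ^ r = K y * F y ^ r := by
    intro y
    rw [ENNReal.mul_rpow_of_nonneg _ _ hr0.le, ← ENNReal.rpow_mul, one_div_mul_cancel hr0.ne',
      ENNReal.rpow_one]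
  simp only [e1, e2, e3] at h
  refine (ENNReal.rpow_le_rpow h hr0.le).trans_eq ?_
  rw [ENNReal.mul_rpow_of_nonneg _ _ hr0.le, ← ENNReal.rpow_mul, ← ENNReal.rpow_mul,
    one_div_mul_cancel hr0.ne', ENNReal.rpow_one]
  congr 2
  have : 1 / r' = 1 - 1 / r := by linarith
  rw [this]
  field_simp

theorem ae_neg_add [MeasurableAdd₂ G] [MeasurableNeg G] [μ.IsAddLeftInvariant]
    [μ.IsNegInvariant] {P : G → Prop} (h : ∀ᵐ y ∂μ, P y) (x : G) : ∀ᵐ y ∂μ, P (-y + x) := by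
  have : MeasurePreserving (fun y : G => -y + x) μ μ :=
    (measurePreserving_add_right μ x).comp (Measure.measurePreserving_neg μ)
  exact this.quasiMeasurePreserving.ae h

variable [MeasurableAdd₂ G] [MeasurableNeg G] [SFinite μ] [μ.IsAddLeftInvariant]
  [μ.IsNegInvariant]

/-- For finite p: the previous inequality inside the integral, then Tonelli and translation
invariance. The general group covers both uses, ℤⁿ with counting measure and ℝⁿ with Lebesgue
measure. -/
theorem eLpNorm_lconvolution_le {K F : G → ℝ≥0∞} (hK : Measurable K) (hF : Measurable F)
    {p : ℝ≥0∞} (hp : 1 ≤ p) :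
    eLpNorm (lconvolution K F μ) p μ ≤ (∫⁻ y, K y ∂μ) * eLpNorm F p μ := by
  rcases eq_or_ne p ⊤ with rfl | hpt
  · rw [eLpNorm_exponent_top, eLpNorm_exponent_top]
    refine essSup_le_of_ae_le _ (ae_of_all _ fun x => ?_)
    simp only [enorm_eq_self, lconvolution_def]
    have h1 := ae_neg_add (μ := μ) (ENNReal.ae_le_essSup F) x
    calc ∫⁻ y, K y * F (-y + x) ∂μ ≤ ∫⁻ y, K y * essSup F μ ∂μ :=
          lintegral_mono_ae (h1.mono fun y hy => by gcongr)
      _ = (∫⁻ y, K y ∂μ) * eLpNormEssSup F μ := by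
          rw [lintegral_mul_const _ hK]; rfl
  · have hp0 : p ≠ 0 := (one_pos.trans_le hp).ne'
    have hr : 1 ≤ p.toReal := by
      simpa using ENNReal.toReal_mono hpt hp
    set r := p.toReal
    have hr0 : 0 < r := by linarith
    rw [eLpNorm_eq_lintegral_rpow_enorm_toReal hp0 hpt,
      eLpNorm_eq_lintegral_rpow_enorm_toReal hp0 hpt]
    simp only [enorm_eq_self]
    have key : ∫⁻ x, (lconvolution K F μ x) ^ r ∂μ ≤ (∫⁻ y, K y ∂μ) ^ r * ∫⁻ x, F x ^ r ∂μ := by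
      calc ∫⁻ x, (lconvolution K F μ x) ^ r ∂μ
          ≤ ∫⁻ x, (∫⁻ y, K y ∂μ) ^ (r - 1) * ∫⁻ y, K y * F (-y + x) ^ r ∂μ ∂μ :=
            lintegral_mono fun x => lintegral_mul_rpow_le hK (by fun_prop) hr
        _ = (∫⁻ y, K y ∂μ) ^ (r - 1) * ∫⁻ x, ∫⁻ y, K y * F (-y + x) ^ r ∂μ ∂μ := by
            rw [lintegral_const_mul]
            fun_prop
        _ = (∫⁻ y, K y ∂μ) ^ (r - 1) * ∫⁻ y, ∫⁻ x, K y * F (-y + x) ^ r ∂μ ∂μ := by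
            rw [lintegral_lintegral_swap]
            fun_prop
        _ = (∫⁻ y, K y ∂μ) ^ (r - 1) * ∫⁻ y, K y * ∫⁻ x, F x ^ r ∂μ ∂μ := by
            congr 2
            ext y
            rw [lintegral_const_mul _ (by fun_prop),
              lintegral_add_left_eq_self (fun x => F x ^ r) (-y)]
        _ = (∫⁻ y, K y ∂μ) ^ r * ∫⁻ x, F x ^ r ∂μ := by
            rw [lintegral_mul_const _ hK, ← mul_assoc]
            congr 1
            conv_lhs => rw [← ENNReal.rpow_one (∫⁻ y, K y ∂μ), ← ENNReal.rpow_mul, one_mul]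
            rw [← ENNReal.rpow_add_of_nonneg _ _ (by linarith) zero_le_one]
            congr 1
            ring
    refine (ENNReal.rpow_le_rpow key (by positivity)).trans_eq ?_
    rw [ENNReal.mul_rpow_of_nonneg _ _ (by positivity), ← ENNReal.rpow_mul,
      mul_one_div_cancel hr0.ne', ENNReal.rpow_one]

end Young

/-! ## Sequence spaces -/

section Sequence

theorem lqNorm_eq_eLpNorm {ι : Type*} [MeasurableSpace ι] [MeasurableSingletonClass ι]
    {q : ℝ≥0∞} (hq : 1 ≤ q) (a : ι → ℝ≥0∞) :
    lqNorm q a = eLpNorm a q Measure.count := by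
  rcases eq_or_ne q ⊤ with rfl | hqt
  · simp only [lqNorm, if_true, eLpNorm_exponent_top, eLpNormEssSup, enorm_eq_self]
    rw [essSup_count]
  · rw [eLpNorm_eq_lintegral_rpow_enorm_toReal (one_pos.trans_le hq).ne' hqt]
    simp only [lqNorm, if_neg hqt, enorm_eq_self, lintegral_count]

variable {ι : Type*}

theorem lqNorm_mono {q : ℝ≥0∞} {a b : ι → ℝ≥0∞} (h : ∀ k, a k ≤ b k) :
    lqNorm q a ≤ lqNorm q b := by
  unfold lqNorm
  split_ifs
  · exact iSup_mono h
  · gcongr with k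
    exact h k

theorem lqNorm_const_mul {q : ℝ≥0∞} (hq : 1 ≤ q) (c : ℝ≥0∞) (a : ι → ℝ≥0∞) :
    lqNorm q (fun k => c * a k) = c * lqNorm q a := by
  unfold lqNorm
  split_ifs with h
  · rw [ENNReal.mul_iSup]
  · have h1 : 0 < q.toReal := ENNReal.toReal_pos (one_pos.trans_le hq).ne' h
    simp only [ENNReal.mul_rpow_of_nonneg _ _ h1.le, ENNReal.tsum_mul_left]
    rw [ENNReal.mul_rpow_of_nonneg _ _ (by positivity), ← ENNReal.rpow_mul,
      mul_one_div_cancel h1.ne', ENNReal.rpow_one]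

theorem lqNorm_add_le {q : ℝ≥0∞} (hq : 1 ≤ q) (a b : ι → ℝ≥0∞) :
    lqNorm q (fun k => a k + b k) ≤ lqNorm q a + lqNorm q b := by
  let _ : MeasurableSpace ι := ⊤
  have : MeasurableSingletonClass ι := ⟨fun _ => trivial⟩
  rw [lqNorm_eq_eLpNorm hq, lqNorm_eq_eLpNorm hq, lqNorm_eq_eLpNorm hq]
  exact eLpNorm_add_le (measurable_from_top.aestronglyMeasurable)
    (measurable_from_top.aestronglyMeasurable) hq

theorem tsum_mul_le_lqNorm_mul_lqNorm {q q' : ℝ≥0∞} (hqq : 1 / q + 1 / q' = 1)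
    (a b : ι → ℝ≥0∞) : ∑' k, a k * b k ≤ lqNorm q a * lqNorm q' b := by
  have h1top : ∀ a b : ι → ℝ≥0∞, ∑' k, a k * b k ≤ lqNorm 1 a * lqNorm ⊤ b := by
    intro a b
    simp only [lqNorm, if_true, ENNReal.one_ne_top, if_false, ENNReal.toReal_one,
      ENNReal.rpow_one, div_one]
    rw [← ENNReal.tsum_mul_right]
    exact ENNReal.tsum_le_tsum fun k => by gcongr; exact le_iSup b k
  rcases eq_or_ne q ⊤ with rfl | hq
  · have : q' = 1 := by simpa using hqq
    subst this
    simp only [mul_comm (a _)]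
    rw [mul_comm (lqNorm _ _)]
    exact h1top b a
  rcases eq_or_ne q' ⊤ with rfl | hq'
  · have : q = 1 := by simpa using hqq
    subst this
    exact h1top a b
  have hc : q.HolderConjugate q' := by
    rw [ENNReal.holderConjugate_iff]; simpa [one_div] using hqq
  have h1 : q ≠ 1 := by
    rintro rfl
    have : q' = ⊤ := by
      have h2 : (1 : ℝ≥0∞) + 1 / q' = 1 + 0 := by simpa using hqq
      have := (ENNReal.add_right_inj ENNReal.one_ne_top).1 h2
      simpa using this
    exact hq' this
  have hq0 : q ≠ 0 := by rintro rfl; simp at hqq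
  have hq'0 : q' ≠ 0 := by rintro rfl; simp at hqq
  have hr : q.toReal.HolderConjugate q'.toReal := by
    refine ⟨?_, ENNReal.toReal_pos hq0 hq, ENNReal.toReal_pos hq'0 hq'⟩
    have := congrArg ENNReal.toReal hqq
    rw [ENNReal.toReal_add (by simp [hq0]) (by simp [hq'0])] at this
    simpa using this
  let _ : MeasurableSpace ι := ⊤
  have : MeasurableSingletonClass ι := ⟨fun _ => trivial⟩
  have := ENNReal.lintegral_mul_le_Lp_mul_Lq (Measure.count : Measure ι) hr
    (f := a) (g := b) measurable_from_top.aemeasurable measurable_from_top.aemeasurable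
  simpa only [lintegral_count, lqNorm, if_neg hq, if_neg hq', Pi.mul_apply] using this

theorem lqNorm_ne_top_of_tsum_ne_top {q : ℝ≥0∞} (hq : 1 ≤ q) {a : ι → ℝ≥0∞} (ha : ∀ k, a k ≤ 1)
    (h : ∑' k, a k ≠ ⊤) : lqNorm q a ≠ ⊤ := by
  unfold lqNorm
  split_ifs with hqt
  · exact ne_top_of_le_ne_top ENNReal.one_ne_top (iSup_le ha)
  · have h1 : 1 ≤ q.toReal := by simpa using ENNReal.toReal_mono hqt hq
    refine ENNReal.rpow_ne_top_of_nonneg (by positivity) (ne_top_of_le_ne_top h ?_)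
    refine ENNReal.tsum_le_tsum fun k => ?_
    simpa using ENNReal.rpow_le_rpow_of_exponent_ge (ha k) h1

variable [AddCommGroup ι] [Countable ι]

theorem lqNorm_convolution_le {q : ℝ≥0∞} (hq : 1 ≤ q) (a b : ι → ℝ≥0∞) :
    lqNorm q (fun k => ∑' j, a j * b (k - j)) ≤ (∑' j, a j) * lqNorm q b := by
  let _ : MeasurableSpace ι := ⊤
  have : MeasurableSingletonClass ι := ⟨fun _ => trivial⟩
  have : DiscreteMeasurableSpace ι := ⟨fun _ => trivial⟩
  have := eLpNorm_lconvolution_le (μ := (Measure.count : Measure ι)) (K := a) (F := b)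
    measurable_from_top measurable_from_top hq
  rw [lqNorm_eq_eLpNorm hq, lqNorm_eq_eLpNorm hq]
  refine le_trans (le_of_eq ?_) (this.trans_eq ?_)
  · congr 1
    ext k
    simp only [lconvolution_def, lintegral_count, neg_add_eq_sub]
  · rw [lintegral_count]

/-- Substituting m = k - j - l shows a double convolution of a, the indicator of S and b. Young's
inequality applies twice, and the indicator has ℓ¹ norm card S. -/
theorem lqNorm_tsum_indicator_le {q : ℝ≥0∞} (hq : 1 ≤ q) (S : Finset ι) (a b : ι → ℝ≥0∞) :
    lqNorm q (fun k => ∑' j, ∑' l, (S : Set ι).indicator 1 (k - j - l) * (a j * b l)) ≤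
      S.card * (∑' j, a j) * lqNorm q b := by
  have e1 : ∀ k : ι, ∑' j, ∑' l, (S : Set ι).indicator 1 (k - j - l) * (a j * b l) =
      ∑' j, a j * ∑' m, (S : Set ι).indicator 1 m * b (k - j - m) := by
    intro k
    refine tsum_congr fun j => ?_
    rw [← ENNReal.tsum_mul_left, ← (Equiv.subLeft (k - j)).tsum_eq]
    refine tsum_congr fun m => ?_
    simp only [Equiv.subLeft_apply, sub_sub_cancel]
    ring
  simp only [e1]
  refine (lqNorm_convolution_le hq a
    (fun k => ∑' m, (S : Set ι).indicator 1 m * b (k - m))).trans ?_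
  have h2 := lqNorm_convolution_le hq ((S : Set ι).indicator 1) b
  have h3 : ∑' m, (S : Set ι).indicator (1 : ι → ℝ≥0∞) m = S.card := by
    rw [← tsum_subtype]
    simp
  rw [h3] at h2
  calc (∑' j, a j) * lqNorm q (fun k => ∑' m, (S : Set ι).indicator 1 m * b (k - m))
      ≤ (∑' j, a j) * (S.card * lqNorm q b) := by gcongr
    _ = _ := by ring

/-- The sum is split along e j + e l. In each half the sequence carrying e is put in ℓ¹ by Hölder
while the other stays in ℓ^q; the condition k - j - l ∈ S is symmetric in j and l, so both halves
have the same form. -/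
theorem lqNorm_weighted_convolution_le {q q' : ℝ≥0∞} (hq : 1 ≤ q) (hqq : 1 / q + 1 / q' = 1)
    (S : Finset ι) (C : ℝ≥0∞) (a b e h : ι → ℝ≥0∞)
    (hh : ∀ k, h k ≤ C * ∑' j, ∑' l, (S : Set ι).indicator 1 (k - j - l) *
      (a j * b l * (e j + e l))) :
    lqNorm q h ≤ C * (2 * S.card) * lqNorm q' e * lqNorm q a * lqNorm q b := by
  refine (lqNorm_mono hh).trans ?_
  rw [lqNorm_const_mul hq]
  have split : ∀ k, ∑' j, ∑' l, (S : Set ι).indicator 1 (k - j - l) * (a j * b l * (e j + e l)) =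
      (∑' j, ∑' l, (S : Set ι).indicator 1 (k - j - l) * ((a j * e j) * b l)) +
      ∑' j, ∑' l, (S : Set ι).indicator 1 (k - j - l) * ((b j * e j) * a l) := by
    intro k
    rw [ENNReal.tsum_comm (f := fun j l => (S : Set ι).indicator 1 (k - j - l) * ((b j * e j) * a l)),
      ← ENNReal.tsum_add]
    refine tsum_congr fun j => ?_
    rw [← ENNReal.tsum_add]
    refine tsum_congr fun l => ?_
    rw [sub_right_comm k l j]
    ring
  simp only [split]
  have h1 := lqNorm_tsum_indicator_le hq S (fun j => a j * e j) b
  have h2 := lqNorm_tsum_indicator_le hq S (fun j => b j * e j) a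
  have h3 := tsum_mul_le_lqNorm_mul_lqNorm hqq a e
  have h4 := tsum_mul_le_lqNorm_mul_lqNorm hqq b e
  calc C * lqNorm q _ ≤ C * (_ + _) := by gcongr; exact lqNorm_add_le hq _ _
    _ ≤ C * (S.card * (lqNorm q a * lqNorm q' e) * lqNorm q b +
          S.card * (lqNorm q b * lqNorm q' e) * lqNorm q a) := by
        gcongr
        · exact h1.trans (by gcongr)
        · exact h2.trans (by gcongr)
    _ = _ := by ring

end Sequence

noncomputable section

/-! ## Fourier multipliers as convolution operators -/

section Multiplier

variable {E : Type*} [NormedAddCommGroup E] [InnerProductSpace ℝ E] [FiniteDimensional ℝ E]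
  [MeasurableSpace E] [BorelSpace E]

theorem integral_fourier_mul_eq_integral_mul_fourier {f g : E → ℂ} (hf : Integrable f)
    (hg : Integrable g) : ∫ ξ, 𝓕 f ξ * g ξ = ∫ x, f x * 𝓕 g x := by
  simpa using! VectorFourier.integral_bilin_fourierIntegral_eq_flip (ContinuousLinearMap.mul ℂ ℂ)
    (L := innerₗ E) Real.continuous_fourierChar continuous_inner hf hg

theorem integral_fourierInv_mul_eq_integral_mul_fourierInv {f g : E → ℂ} (hf : Integrable f)
    (hg : Integrable g) : ∫ ξ, 𝓕⁻ f ξ * g ξ = ∫ x, f x * 𝓕⁻ g x := by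
  have hf' : Integrable fun x => f (-x) := hf.comp_neg
  rw [Real.fourierInv_eq_fourier_comp_neg f,
    integral_fourier_mul_eq_integral_mul_fourier hf' hg, ← integral_neg_eq_self]
  simp [Real.fourierInv_eq_fourier_neg]

theorem fourierInv_char_smul (a : E → ℂ) (x y : E) :
    𝓕⁻ (fun ξ => Real.fourierChar (-inner ℝ ξ y) • a ξ) x = 𝓕⁻ a (x - y) := by
  rw [Real.fourierInv_eq, Real.fourierInv_eq]
  congr 1
  ext ξ
  rw [smul_smul, ← AddChar.map_add_eq_mul, inner_sub_right, sub_eq_add_neg]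

theorem fourier_char_smul_comp_sub (κ : E → ℂ) (y ξ ζ : E) :
    𝓕 (fun x => Real.fourierChar (inner ℝ x ξ) • κ (x - y)) ζ =
      Real.fourierChar (-inner ℝ y (ζ - ξ)) • 𝓕 κ (ζ - ξ) := by
  rw [Real.fourier_eq, Real.fourier_eq, ← integral_add_right_eq_self _ y]
  simp only [add_sub_cancel_right, Circle.smul_def]
  rw [← integral_smul]
  congr 1
  ext x
  simp only [smul_smul, ← Circle.coe_mul, ← AddChar.map_add_eq_mul]
  congr 3
  simp only [inner_add_left, inner_sub_right]
  ring

/-- The convolution of a Schwartz function with a function in some `L^p`. -/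
def kernelConv (κ : 𝓢(E, ℂ)) (f : E → ℂ) (x : E) : ℂ := ∫ y, κ (x - y) * f y

theorem schwartz_eLpNorm_ne_top (κ : 𝓢(E, ℂ)) (p : ℝ≥0∞) :
    eLpNorm κ p (volume : Measure E) ≠ ⊤ :=
  (κ.memLp p volume).eLpNorm_ne_top

variable {p : ℝ≥0∞}

theorem stronglyMeasurable_kernel_mul (κ : 𝓢(E, ℂ)) (f : Lp ℂ p (volume : Measure E)) :
    StronglyMeasurable (fun z : E × E => κ (z.1 - z.2) * f z.2) :=
  (κ.continuous.comp (by fun_prop : Continuous fun z : E × E => z.1 - z.2)).stronglyMeasurable.mul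
    ((Lp.stronglyMeasurable f).comp_measurable measurable_snd)

theorem lintegral_kernel_mul_le_of_holderTriple {r : ℝ≥0∞} [hT : ENNReal.HolderTriple r p 1]
    (κ : 𝓢(E, ℂ)) (f : Lp ℂ p (volume : Measure E)) (x : E) :
    ∫⁻ y, ‖κ (x - y) * f y‖ₑ ≤ eLpNorm κ r volume * eLpNorm f p volume := by
  have hmp : MeasurePreserving (fun y : E => x - y) volume volume :=
    Measure.measurePreserving_sub_left volume x
  have hm : AEStronglyMeasurable (⇑κ ∘ fun y : E => x - y) volume :=
    (κ.continuous.comp (continuous_const.sub continuous_id)).aestronglyMeasurable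
  have h := eLpNorm_smul_le_mul_eLpNorm (r := 1) (Lp.aestronglyMeasurable f) hm
    (p := r) (q := p)
  rw [eLpNorm_comp_measurePreserving κ.continuous.aestronglyMeasurable hmp,
    eLpNorm_one_eq_lintegral_enorm] at h
  exact h

/-- Here and below `(1 - p⁻¹)⁻¹` is the conjugate exponent of `p`; the conventions in `ℝ≥0∞` give
the right values at p = 1 and p = ∞. -/
theorem kernelBound_ne_top (κ : 𝓢(E, ℂ)) (f : Lp ℂ p (volume : Measure E)) :
    eLpNorm κ (1 - p⁻¹)⁻¹ volume * eLpNorm f p volume ≠ ⊤ :=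
  ENNReal.mul_ne_top (schwartz_eLpNorm_ne_top κ _) (Lp.eLpNorm_ne_top f)

theorem stronglyMeasurable_kernelConv (κ : 𝓢(E, ℂ)) (f : Lp ℂ p (volume : Measure E)) :
    StronglyMeasurable (kernelConv κ f) :=
  (stronglyMeasurable_kernel_mul κ f).integral_prod_right

variable [hp : Fact (1 ≤ p)]

theorem lintegral_kernel_mul_le (κ : 𝓢(E, ℂ)) (f : Lp ℂ p (volume : Measure E)) (x : E) :
    ∫⁻ y, ‖κ (x - y) * f y‖ₑ ≤ eLpNorm κ (1 - p⁻¹)⁻¹ volume * eLpNorm f p volume := by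
  have : ENNReal.HolderConjugate p (1 - p⁻¹)⁻¹ := ENNReal.HolderConjugate.inv_one_sub_inv' hp.out
  have hT := ENNReal.HolderConjugate.symm (hpq := this)
  exact lintegral_kernel_mul_le_of_holderTriple κ f x

theorem integrable_kernel_mul (κ : 𝓢(E, ℂ)) (f : Lp ℂ p (volume : Measure E)) (x : E) :
    Integrable (fun y => κ (x - y) * f y) :=
  ⟨((stronglyMeasurable_kernel_mul κ f).comp_measurable
    (measurable_prodMk_left (x := x))).aestronglyMeasurable,
    (lintegral_kernel_mul_le κ f x).trans_lt (kernelBound_ne_top κ f).lt_top⟩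

theorem enorm_kernelConv_le (κ : 𝓢(E, ℂ)) (f : Lp ℂ p (volume : Measure E)) (x : E) :
    ‖kernelConv κ f x‖ₑ ≤ eLpNorm κ (1 - p⁻¹)⁻¹ volume * eLpNorm f p volume :=
  (enorm_integral_le_lintegral_enorm _).trans (lintegral_kernel_mul_le κ f x)

theorem eLpNorm_top_kernelConv_le (κ : 𝓢(E, ℂ)) (f : Lp ℂ p (volume : Measure E)) :
    eLpNorm (kernelConv κ f) ⊤ volume ≤ eLpNorm κ (1 - p⁻¹)⁻¹ volume * eLpNorm f p volume := by
  rw [eLpNorm_exponent_top]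
  exact essSup_le_of_ae_le _ (ae_of_all _ fun x => enorm_kernelConv_le κ f x)

theorem eLpNorm_kernelConv_le (κ : 𝓢(E, ℂ)) (f : Lp ℂ p (volume : Measure E)) :
    eLpNorm (kernelConv κ f) p volume ≤ eLpNorm κ 1 volume * eLpNorm f p volume := by
  have hκ : Measurable fun x => ‖κ x‖ₑ := κ.continuous.measurable.enorm
  have hf : Measurable fun x => ‖f x‖ₑ := (Lp.stronglyMeasurable f).enorm
  have h := eLpNorm_lconvolution_le (μ := (volume : Measure E)) hκ hf hp.out
  rw [← eLpNorm_one_eq_lintegral_enorm, eLpNorm_enorm] at h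
  refine le_trans (eLpNorm_mono_enorm fun x => ?_) h
  rw [enorm_eq_self, lconvolution_comm, lconvolution_def]
  refine (enorm_integral_le_lintegral_enorm _).trans (lintegral_mono fun y => ?_)
  rw [enorm_mul, mul_comm, neg_add_eq_sub]

theorem memLp_kernelConv (κ : 𝓢(E, ℂ)) (f : Lp ℂ p (volume : Measure E)) :
    MemLp (kernelConv κ f) p volume :=
  ⟨(stronglyMeasurable_kernelConv κ f).aestronglyMeasurable,
    (eLpNorm_kernelConv_le κ f).trans_lt
      (ENNReal.mul_ne_top (schwartz_eLpNorm_ne_top κ 1) (Lp.eLpNorm_ne_top f)).lt_top⟩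

theorem memLp_top_kernelConv (κ : 𝓢(E, ℂ)) (f : Lp ℂ p (volume : Measure E)) :
    MemLp (kernelConv κ f) ⊤ volume :=
  ⟨(stronglyMeasurable_kernelConv κ f).aestronglyMeasurable,
    (eLpNorm_top_kernelConv_le κ f).trans_lt (kernelBound_ne_top κ f).lt_top⟩

/-- Fubini applies because h is integrable and the integral of |κ(x-y) f(y)| over y is bounded
uniformly in x. -/
theorem integral_mul_kernelConv (κ : 𝓢(E, ℂ)) (f : Lp ℂ p (volume : Measure E)) {h : E → ℂ}
    (hh : Integrable h) :
    ∫ x, h x * kernelConv κ f x = ∫ y, (∫ x, h x * κ (x - y)) * f y := by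
  have hm : AEStronglyMeasurable (fun z : E × E => h z.1 * (κ (z.1 - z.2) * f z.2))
      (volume.prod volume) :=
    hh.1.comp_fst.mul (stronglyMeasurable_kernel_mul κ f).aestronglyMeasurable
  have hint : Integrable (fun z : E × E => h z.1 * (κ (z.1 - z.2) * f z.2))
      (volume.prod volume) := by
    rw [integrable_prod_iff hm]
    refine ⟨ae_of_all _ fun x => (integrable_kernel_mul κ f x).const_mul (h x), ?_⟩
    refine Integrable.mono' (hh.norm.mul_const
      (eLpNorm κ (1 - p⁻¹)⁻¹ volume * eLpNorm f p volume).toReal)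
      hm.norm.integral_prod_right' (ae_of_all _ fun x => ?_)
    rw [Real.norm_of_nonneg (by positivity)]
    simp only [norm_mul (h x), integral_const_mul]
    gcongr
    rw [integral_norm_eq_lintegral_enorm (integrable_kernel_mul κ f x).1]
    exact ENNReal.toReal_mono (kernelBound_ne_top κ f) (lintegral_kernel_mul_le κ f x)
  calc ∫ x, h x * kernelConv κ f x = ∫ x, ∫ y, h x * (κ (x - y) * f y) := by
        simp only [kernelConv, integral_const_mul]
    _ = ∫ y, ∫ x, h x * (κ (x - y) * f y) := integral_integral_swap hint
    _ = _ := by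
        simp only [← mul_assoc, integral_mul_const]

/-- The multiplier transposed to test functions is integration against 𝓕⁻ a. This identifies the
distributional multiplier with convolution by 𝓕⁻ a. -/
theorem fourier_smulLeft_fourierInv_apply (a φ : 𝓢(E, ℂ)) (y : E) :
    𝓕 (SchwartzMap.smulLeftCLM ℂ a (𝓕⁻ φ)) y = ∫ x, φ x * (𝓕⁻ a) (x - y) := by
  have ha : Integrable (fun ξ => Real.fourierChar (-inner ℝ ξ y) • a ξ) :=
    (Real.fourierIntegral_convergent_iff y).2 a.integrable
  rw [SchwartzMap.fourier_coe, Real.fourier_eq]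
  have h := integral_fourierInv_mul_eq_integral_mul_fourierInv φ.integrable ha
  simp only [fourierInv_char_smul, ← SchwartzMap.fourierInv_coe] at h
  rw [← h]
  congr 1
  ext ξ
  rw [SchwartzMap.smulLeftCLM_apply_apply a.hasTemperateGrowth]
  simp only [Circle.smul_def, smul_eq_mul]
  ring

/-- The Fourier multiplier with symbol `a`, as an operator on `L^p`. -/
def multiplierLp (a : 𝓢(E, ℂ)) : Lp ℂ p (volume : Measure E) →ₗ[ℂ] Lp ℂ p (volume : Measure E) where
  toFun f := (memLp_kernelConv (𝓕⁻ a) f).toLp _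
  map_add' f g := by
    rw [← MemLp.toLp_add, MemLp.toLp_eq_toLp_iff]
    refine ae_of_all _ fun x => ?_
    simp only [kernelConv, Pi.add_apply]
    rw [← integral_add (integrable_kernel_mul _ f x) (integrable_kernel_mul _ g x)]
    refine integral_congr_ae ((Lp.coeFn_add f g).mono fun y hy => ?_)
    simp only [hy, Pi.add_apply, mul_add]
  map_smul' c f := by
    rw [RingHom.id_apply, ← MemLp.toLp_const_smul, MemLp.toLp_eq_toLp_iff]
    refine ae_of_all _ fun x => ?_
    simp only [kernelConv, Pi.smul_apply, ← integral_smul]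
    refine integral_congr_ae ((Lp.coeFn_smul c f).mono fun y hy => ?_)
    simp only [hy, Pi.smul_apply, smul_eq_mul]
    ring

/-- The Fourier multiplier with symbol `a`, as an operator from `L^p` to `L^∞`. -/
def multiplierTop (a : 𝓢(E, ℂ)) (f : Lp ℂ p (volume : Measure E)) :
    Lp ℂ ⊤ (volume : Measure E) :=
  (memLp_top_kernelConv (𝓕⁻ a) f).toLp _

theorem coeFn_multiplierLp (a : 𝓢(E, ℂ)) (f : Lp ℂ p (volume : Measure E)) :
    multiplierLp a f =ᵐ[volume] kernelConv (𝓕⁻ a) f :=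
  (memLp_kernelConv (𝓕⁻ a) f).coeFn_toLp

theorem coeFn_multiplierTop (a : 𝓢(E, ℂ)) (f : Lp ℂ p (volume : Measure E)) :
    multiplierTop a f =ᵐ[volume] kernelConv (𝓕⁻ a) f :=
  (memLp_top_kernelConv (𝓕⁻ a) f).coeFn_toLp

theorem enorm_multiplierLp_le (a : 𝓢(E, ℂ)) (f : Lp ℂ p (volume : Measure E)) :
    ‖multiplierLp a f‖ₑ ≤ eLpNorm (𝓕⁻ a : 𝓢(E, ℂ)) 1 volume * ‖f‖ₑ := by
  rw [Lp.enorm_def, Lp.enorm_def, eLpNorm_congr_ae (coeFn_multiplierLp a f)]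
  exact eLpNorm_kernelConv_le _ f

theorem enorm_multiplierTop_le (a : 𝓢(E, ℂ)) (f : Lp ℂ p (volume : Measure E)) :
    ‖multiplierTop a f‖ₑ ≤ eLpNorm (𝓕⁻ a : 𝓢(E, ℂ)) (1 - p⁻¹)⁻¹ volume * ‖f‖ₑ := by
  rw [Lp.enorm_def, Lp.enorm_def, eLpNorm_congr_ae (coeFn_multiplierTop a f)]
  exact eLpNorm_top_kernelConv_le _ f

theorem continuous_multiplierLp (a : 𝓢(E, ℂ)) :
    Continuous (multiplierLp a : Lp ℂ p (volume : Measure E) → Lp ℂ p (volume : Measure E)) := by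
  refine AddMonoidHomClass.continuous_of_bound (multiplierLp a)
    (eLpNorm (𝓕⁻ a : 𝓢(E, ℂ)) 1 (volume : Measure E)).toReal fun f => ?_
  have h := enorm_multiplierLp_le a f
  have h1 : eLpNorm (𝓕⁻ a : 𝓢(E, ℂ)) 1 (volume : Measure E) ≠ ⊤ := schwartz_eLpNorm_ne_top _ _
  rw [← toReal_enorm, ← toReal_enorm f, ← ENNReal.toReal_mul]
  exact ENNReal.toReal_mono (ENNReal.mul_ne_top h1 enorm_ne_top) h

theorem integral_mul_kernelConv_fourierInv (a φ : 𝓢(E, ℂ)) (f : Lp ℂ p (volume : Measure E)) :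
    ∫ x, φ x * kernelConv (𝓕⁻ a) f x =
      Lp.toTemperedDistribution f (𝓕 (SchwartzMap.smulLeftCLM ℂ a (𝓕⁻ φ))) := by
  rw [Lp.toTemperedDistribution_apply, integral_mul_kernelConv _ f φ.integrable]
  simp only [fourier_smulLeft_fourierInv_apply, smul_eq_mul]

theorem toTemperedDistribution_multiplierLp (a : 𝓢(E, ℂ)) (f : Lp ℂ p (volume : Measure E)) :
    Lp.toTemperedDistribution (multiplierLp a f) =
      TemperedDistribution.fourierMultiplierCLM ℂ a (Lp.toTemperedDistribution f) := by
  ext φ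
  rw [TemperedDistribution.fourierMultiplierCLM_apply_apply,
    ← integral_mul_kernelConv_fourierInv, Lp.toTemperedDistribution_apply]
  refine integral_congr_ae ((coeFn_multiplierLp a f).mono fun x hx => ?_)
  simp only [hx, smul_eq_mul]

theorem toTemperedDistribution_multiplierTop (a : 𝓢(E, ℂ)) (f : Lp ℂ p (volume : Measure E)) :
    Lp.toTemperedDistribution (multiplierTop a f) =
      TemperedDistribution.fourierMultiplierCLM ℂ a (Lp.toTemperedDistribution f) := by
  ext φ
  rw [TemperedDistribution.fourierMultiplierCLM_apply_apply,
    ← integral_mul_kernelConv_fourierInv, Lp.toTemperedDistribution_apply]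
  refine integral_congr_ae ((coeFn_multiplierTop a f).mono fun x hx => ?_)
  simp only [hx, smul_eq_mul]

theorem toTemperedDistribution_injective :
    Function.Injective (Lp.toTemperedDistribution : Lp ℂ p (volume : Measure E) → 𝓢'(E, ℂ)) :=
  LinearMap.ker_eq_bot.1
    (Lp.ker_toTemperedDistributionCLM_eq_bot (F := ℂ) (μ := (volume : Measure E)) (p := p))

/-- Moving the Fourier transform off φ turns the integral into one of φ(ξ+η) b(η) times a character
in η, and this integrand vanishes identically. -/
theorem fourierInv_fourier_mul_comp_sub_eq_zero (b φ : 𝓢(E, ℂ)) (y ξ : E)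
    (h : ∀ η, b η ≠ 0 → φ (ξ + η) = 0) :
    ∫ x, Real.fourierChar (inner ℝ x ξ) • (𝓕 φ x * (𝓕⁻ b) (x - y)) = 0 := by
  have hint : Integrable fun x => Real.fourierChar (inner ℝ x ξ) • (𝓕⁻ b) (x - y) := by
    have := (Real.fourierIntegral_convergent_iff (-ξ)).2
      (SchwartzMap.integrable (μ := volume) (𝓕⁻ b : 𝓢(E, ℂ)) |>.comp_sub_right y)
    simpa using this
  have h1 := integral_fourier_mul_eq_integral_mul_fourier φ.integrable hint
  simp only [fourier_char_smul_comp_sub, ← SchwartzMap.fourier_coe,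
    FourierTransform.fourier_fourierInv_eq] at h1
  calc _ = ∫ x, 𝓕 φ x * (Real.fourierChar (inner ℝ x ξ) • (𝓕⁻ b) (x - y)) := by
        congr 1
        ext x
        simp only [Circle.smul_def, smul_eq_mul]
        ring
    _ = _ := h1
    _ = 0 := by
        refine integral_eq_zero_of_ae (ae_of_all _ fun ζ => ?_)
        by_cases hb : b (ζ - ξ) = 0
        · simp [hb]
        · have := h _ hb
          rw [add_sub_cancel] at this
          simp [this]

/-- The Fourier transform of a product of two band-limited functions vanishes away from the sum
of the supports of the symbols. -/
theorem integral_fourier_mul_kernelConv_mul_kernelConv {r : ℝ≥0∞} [Fact (1 ≤ r)]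
    (a b φ : 𝓢(E, ℂ)) (f : Lp ℂ p (volume : Measure E)) (g : Lp ℂ r (volume : Measure E))
    (h : ∀ ξ η, a ξ ≠ 0 → b η ≠ 0 → φ (ξ + η) = 0) :
    ∫ x, 𝓕 φ x * (kernelConv (𝓕⁻ a) f x * kernelConv (𝓕⁻ b) g x) = 0 := by
  have hh : Integrable fun x => 𝓕 φ x * kernelConv (𝓕⁻ a) f x := by
    have := (memLp_top_kernelConv (𝓕⁻ a) f)
    have h2 := MemLp.integrable_mul ((𝓕 φ).memLp 1) this
    exact h2
  calc _ = ∫ x, 𝓕 φ x * kernelConv (𝓕⁻ a) f x * kernelConv (𝓕⁻ b) g x := by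
        simp only [mul_assoc]
    _ = ∫ y, (∫ x, 𝓕 φ x * kernelConv (𝓕⁻ a) f x * (𝓕⁻ b) (x - y)) * g y :=
        integral_mul_kernelConv _ g hh
    _ = 0 := by
        refine integral_eq_zero_of_ae (ae_of_all _ fun y => ?_)
        have key : ∫ x, 𝓕 φ x * kernelConv (𝓕⁻ a) f x * (𝓕⁻ b) (x - y) = 0 := by
          -- For fixed y the inner integral pairs f with 𝓕 (a · 𝓕⁻ ψ). The support hypothesis says
          -- exactly that a · 𝓕⁻ ψ = 0.
          set ψ : 𝓢(E, ℂ) := SchwartzMap.pairing (ContinuousLinearMap.mul ℂ ℂ) (𝓕 φ)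
            (SchwartzMap.compSubConstCLM ℂ y (𝓕⁻ b)) with hψ
          have hψx : ∀ x, ψ x = 𝓕 φ x * (𝓕⁻ b) (x - y) := fun x => by simp [hψ]
          have h1 := integral_mul_kernelConv_fourierInv a ψ f
          have h2 : SchwartzMap.smulLeftCLM ℂ a (𝓕⁻ ψ) = 0 := by
            ext ξ
            rw [SchwartzMap.smulLeftCLM_apply_apply a.hasTemperateGrowth]
            by_cases ha : a ξ = 0
            · simp [ha]
            · have : (𝓕⁻ ψ) ξ = 0 := by
                rw [SchwartzMap.fourierInv_coe, Real.fourierInv_eq]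
                simp only [hψx]
                exact fourierInv_fourier_mul_comp_sub_eq_zero b φ y ξ fun η hη => h ξ η ha hη
              simp [this]
          rw [h2] at h1
          simp only [hψx] at h1
          rw [← integral_congr_ae (ae_of_all _ fun x => mul_right_comm _ _ _), h1]
          simp [FourierTransform.fourier_zero]
        simp [key]

end Multiplier

end

section Spectrum

variable {E : Type*} [NormedAddCommGroup E] [InnerProductSpace ℝ E] [FiniteDimensional ℝ E]

/-! ## Supports of tempered distributions and cut-off functions -/

theorem exists_schwartz_eq_one_near {x : E} {U : Set E} (hU : IsOpen U) (hx : x ∈ U) :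
    ∃ χ : 𝓢(E, ℂ), tsupport χ ⊆ U ∧ ∃ V, IsOpen V ∧ x ∈ V ∧ ∀ y ∈ V, χ y = 1 := by
  obtain ⟨r, hr, hrU⟩ := Metric.nhds_basis_closedBall.mem_iff.1 (hU.mem_nhds hx)
  let b : ContDiffBump x := ⟨r / 2, r, by positivity, by linarith⟩
  have h1 : HasCompactSupport (Complex.ofRealCLM ∘ b) := b.hasCompactSupport.comp_left rfl
  have h2 : ContDiff ℝ ∞ (Complex.ofRealCLM ∘ b) := Complex.ofRealCLM.contDiff.comp b.contDiff
  refine ⟨h1.toSchwartzMap h2, ?_, Metric.ball x (r / 2), Metric.isOpen_ball,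
    Metric.mem_ball_self (by positivity), fun y hy => ?_⟩
  · refine (tsupport_comp_subset (g := Complex.ofRealCLM) (map_zero _) b).trans ?_
    rw [b.tsupport_eq]
    exact hrU
  · have : b y = 1 := b.one_of_mem_closedBall (Metric.ball_subset_closedBall hy)
    simp [this]

/-- The support is defined locally, so T must be glued over the compact set supp φ. The property
propagated by compactness is the existence of a cut-off χ, equal to 1 near the set, with T(χψ) = 0
for every ψ. -/
theorem apply_eq_zero_of_disjoint_dsupport (T : 𝓢'(E, ℂ)) (φ : 𝓢(E, ℂ))
    (hφ : HasCompactSupport φ) (hd : Disjoint (tsupport φ) (Distribution.dsupport T)) :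
    T φ = 0 := by
  have key : ∃ χ : 𝓢(E, ℂ), (∀ᶠ x in 𝓝ˢ (tsupport φ), χ x = 1) ∧
      ∀ ψ : 𝓢(E, ℂ), T (SchwartzMap.smulLeftCLM ℂ χ ψ) = 0 := by
    refine IsCompact.induction_on (p := fun s => ∃ χ : 𝓢(E, ℂ), (∀ᶠ x in 𝓝ˢ s, χ x = 1) ∧
      ∀ ψ : 𝓢(E, ℂ), T (SchwartzMap.smulLeftCLM ℂ χ ψ) = 0) hφ ⟨0, by simp, fun ψ => ?_⟩ ?_ ?_ ?_
    · have : SchwartzMap.smulLeftCLM ℂ (0 : 𝓢(E, ℂ)) ψ = 0 := by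
        ext x
        rw [SchwartzMap.smulLeftCLM_apply_apply (SchwartzMap.hasTemperateGrowth _)]
        simp
      rw [this, map_zero]
    · rintro s t hst ⟨χ, h1, h2⟩
      exact ⟨χ, h1.filter_mono (nhdsSet_mono hst), h2⟩
    · rintro s t ⟨χ₁, h1, h2⟩ ⟨χ₂, h3, h4⟩
      -- This is 1 - (1-χ₁)(1-χ₂), which equals 1 wherever χ₁ or χ₂ does.
      refine ⟨χ₁ + χ₂ - SchwartzMap.smulLeftCLM ℂ χ₁ χ₂, ?_, fun ψ => ?_⟩
      · rw [nhdsSet_union, eventually_sup]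
        constructor
        · filter_upwards [h1] with x hx
          simp [SchwartzMap.smulLeftCLM_apply_apply (SchwartzMap.hasTemperateGrowth _), hx]
        · filter_upwards [h3] with x hx
          simp [SchwartzMap.smulLeftCLM_apply_apply (SchwartzMap.hasTemperateGrowth _), hx]
      · have : SchwartzMap.smulLeftCLM ℂ (χ₁ + χ₂ - SchwartzMap.smulLeftCLM ℂ χ₁ χ₂ : 𝓢(E, ℂ)) ψ =
            SchwartzMap.smulLeftCLM ℂ χ₁ ψ +
              SchwartzMap.smulLeftCLM ℂ χ₂ (ψ - SchwartzMap.smulLeftCLM ℂ χ₁ ψ) := by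
          ext x
          simp only [SchwartzMap.smulLeftCLM_apply_apply (SchwartzMap.hasTemperateGrowth _),
            add_apply, sub_apply, smul_eq_mul]
          ring
        rw [this, map_add, h2, h4, add_zero]
    · intro x hx
      have hx' : x ∉ Distribution.dsupport T := fun h => hd.le_bot ⟨hx, h⟩
      obtain ⟨U, hUv, hUo, hxU⟩ := (Distribution.notMem_dsupport_iff x).1 hx'
      obtain ⟨χ, hχU, V, hVo, hxV, hV⟩ := exists_schwartz_eq_one_near hUo hxU
      refine ⟨V, mem_nhdsWithin_of_mem_nhds (hVo.mem_nhds hxV), χ, ?_, fun ψ => ?_⟩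
      · rw [hVo.nhdsSet_eq]
        exact hV
      · exact hUv _ ((SchwartzMap.tsupport_smulLeftCLM_subset χ ψ).trans
          (inter_subset_right.trans hχU))
  obtain ⟨χ, h1, h2⟩ := key
  have : SchwartzMap.smulLeftCLM ℂ χ φ = φ := by
    ext x
    rw [SchwartzMap.smulLeftCLM_apply_apply (SchwartzMap.hasTemperateGrowth _)]
    by_cases hx : x ∈ tsupport φ
    · rw [h1.self_of_nhdsSet x hx, one_smul]
    · rw [image_eq_zero_of_notMem_tsupport hx, smul_zero]
  rw [← this, h2]

/-! ## Functions are determined by the compactly supported part of their spectrum -/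

variable [MeasurableSpace E] [BorelSpace E]

theorem exists_schwartz_fourier_ne_zero (R : ℝ) :
    ∃ θ : 𝓢(E, ℂ), HasCompactSupport θ ∧ ∀ x : E, ‖x‖ ≤ R → 𝓕 θ x ≠ 0 := by
  -- The bump lives in the ball of radius 2r, so |⟨ξ, x⟩| ≤ 1/4 for ‖x‖ ≤ R. The phase stays within
  -- π/2, the cosine is nonnegative, and the real part of the transform is positive.
  set r : ℝ := 1 / (8 * (|R| + 1)) with hr
  have hr0 : 0 < r := by positivity
  let b : ContDiffBump (0 : E) := ⟨r, 2 * r, hr0, by linarith⟩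
  have h1 : HasCompactSupport (Complex.ofRealCLM ∘ b) := b.hasCompactSupport.comp_left rfl
  have h2 : ContDiff ℝ ∞ (Complex.ofRealCLM ∘ b) := Complex.ofRealCLM.contDiff.comp b.contDiff
  refine ⟨h1.toSchwartzMap h2, h1, fun x hx h0 => ?_⟩
  set θ := h1.toSchwartzMap h2 with hθ
  have hθx : ∀ ξ, θ ξ = (b ξ : ℂ) := fun ξ => rfl
  have hcos : ∀ ξ : E, (Real.fourierChar (-inner ℝ ξ x) • θ ξ).re =
      b ξ * Real.cos (2 * Real.pi * inner ℝ ξ x) := by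
    intro ξ
    rw [Circle.smul_def, Real.fourierChar_apply, hθx, smul_eq_mul, Complex.re_mul_ofReal,
      Complex.exp_ofReal_mul_I_re, mul_comm]
    congr 1
    rw [← Real.cos_neg]
    ring_nf
  have hre : (𝓕 θ x).re = ∫ ξ, b ξ * Real.cos (2 * Real.pi * inner ℝ ξ x) := by
    rw [SchwartzMap.fourier_coe, Real.fourier_eq]
    have := (integral_re (𝕜 := ℂ) ((Real.fourierIntegral_convergent_iff x).2
      (θ.integrable (μ := volume)))).symm
    refine this.trans ?_
    exact integral_congr_ae (ae_of_all _ hcos)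
  have hpos : 0 < ∫ ξ, b ξ * Real.cos (2 * Real.pi * inner ℝ ξ x) := by
    refine Continuous.integral_pos_of_hasCompactSupport_nonneg_nonzero (x := 0) ?_ ?_ ?_ ?_
    · exact b.continuous.mul (by fun_prop)
    · exact b.hasCompactSupport.mul_right
    · intro ξ
      by_cases hξ : ξ ∈ Metric.ball (0 : E) (2 * r)
      · refine mul_nonneg b.nonneg (Real.cos_nonneg_of_mem_Icc ?_)
        rw [mem_Icc, ← abs_le, abs_mul, abs_of_pos (by positivity : (0 : ℝ) < 2 * Real.pi)]
        have h3 := abs_real_inner_le_norm ξ x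
        rw [mem_ball_zero_iff] at hξ
        have h4 : ‖ξ‖ * ‖x‖ ≤ 2 * r * (|R| + 1) :=
          mul_le_mul hξ.le (hx.trans ((le_abs_self R).trans (by linarith))) (norm_nonneg _)
            (by positivity)
        have h5 : 2 * r * (|R| + 1) = 1 / 4 := by
          rw [hr]; field_simp; norm_num
        have := Real.pi_pos
        nlinarith
      · have : b ξ = 0 := by
          by_contra hne
          have : ξ ∈ Function.support b := hne
          rw [b.support_eq] at this
          exact hξ this
        simp [this]
    · have : b 0 = 1 := b.one_of_mem_closedBall (Metric.mem_closedBall_self hr0.le)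
      simp [this]
  rw [h0, Complex.zero_re] at hre
  exact hpos.ne hre

theorem integrable_schwartz_mul {p : ℝ≥0∞} [hp : Fact (1 ≤ p)] (ψ : 𝓢(E, ℂ))
    (f : Lp ℂ p (volume : Measure E)) : Integrable fun x => ψ x * f x := by
  have : ENNReal.HolderConjugate p (1 - p⁻¹)⁻¹ := ENNReal.HolderConjugate.inv_one_sub_inv' hp.out
  have hT := ENNReal.HolderConjugate.symm (hpq := this)
  exact MemLp.integrable_mul (ψ.memLp (1 - p⁻¹)⁻¹ volume) (Lp.memLp f)

/-- Frequency partitions are finite sums only on compact sets, so only compactly supported φ are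
available as tests. With θ of compact support, U = 𝓕 θ · u is integrable, and its transform at ξ
tests u against the translate of θ by ξ; hence U = 0. Choosing 𝓕 θ without zeros on a large ball
gives u = 0 there. -/
theorem ae_eq_zero_of_integral_fourier_mul_eq_zero {u : E → ℂ}
    (hu : ∀ ψ : 𝓢(E, ℂ), Integrable fun x => ψ x * u x)
    (h : ∀ φ : 𝓢(E, ℂ), HasCompactSupport φ → ∫ x, 𝓕 φ x * u x = 0) : u =ᵐ[volume] 0 := by
  have key : ∀ R : ℕ, ∀ᵐ x : E, ‖x‖ ≤ R → u x = 0 := by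
    intro R
    obtain ⟨θ, hθc, hθ⟩ := exists_schwartz_fourier_ne_zero (E := E) R
    set U : E → ℂ := fun x => 𝓕 θ x * u x with hU
    have hUi : Integrable U := hu (𝓕 θ)
    have hFU : ∀ ξ, 𝓕 U ξ = 0 := by
      intro ξ
      have hc : HasCompactSupport (SchwartzMap.compSubConstCLM ℂ ξ θ) :=
        hθc.comp_homeomorph (Homeomorph.subRight ξ)
      rw [Real.fourier_eq, ← h _ hc]
      congr 1
      ext x
      have e := fourier_char_smul_comp_sub (⇑θ) ξ 0 x
      simp only [inner_zero_right, AddChar.map_zero_eq_one, one_smul, sub_zero] at e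
      have e2 : 𝓕 (SchwartzMap.compSubConstCLM ℂ ξ θ) x = 𝓕 (fun x => θ (x - ξ)) x := rfl
      rw [e2, e, hU, ← SchwartzMap.fourier_coe, real_inner_comm]
      simp only [Circle.smul_def, smul_eq_mul, mul_assoc]
    have hUL : MemLp U 1 volume := memLp_one_iff_integrable.2 hUi
    have hzero : Lp.toTemperedDistribution (hUL.toLp U) = Lp.toTemperedDistribution
        (0 : Lp ℂ 1 (volume : Measure E)) := by
      ext ψ
      have e3 : ∫ x, U x * 𝓕 (𝓕⁻ ψ) x = 0 := by
        rw [SchwartzMap.fourier_coe, ← integral_fourier_mul_eq_integral_mul_fourier hUi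
          (𝓕⁻ ψ).integrable]
        simp [hFU]
      rw [FourierTransform.fourier_fourierInv_eq] at e3
      rw [Lp.toTemperedDistribution_apply, Lp.toTemperedDistribution_apply]
      have e4 : ∫ x, ψ x • (hUL.toLp U) x = ∫ x, U x * ψ x :=
        integral_congr_ae (hUL.coeFn_toLp.mono fun x hx => by simp only [hx, smul_eq_mul, mul_comm])
      have e5 : ∫ x, ψ x • (0 : Lp ℂ 1 (volume : Measure E)) x = 0 :=
        integral_eq_zero_of_ae ((Lp.coeFn_zero ℂ 1 volume).mono fun x hx => by simp)
      rw [e4, e3, e5]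
    have h0 : U =ᵐ[volume] 0 := by
      have := toTemperedDistribution_injective hzero
      exact (MemLp.toLp_eq_toLp_iff hUL MemLp.zero).1 (this.trans (MemLp.toLp_zero _).symm)
    filter_upwards [h0] with x hx hxR
    exact (mul_eq_zero.1 hx).resolve_left (hθ x hxR)
  filter_upwards [ae_all_iff.2 key] with x hx
  obtain ⟨R, hR⟩ := exists_nat_ge ‖x‖
  exact hx R hR

/-! ## Frequency decompositions -/

/-- A family of symbols which is a locally finite partition of unity on the frequency side. -/
def IsFrequencyPartition {ι : Type*} (s : ι → 𝓢(E, ℂ)) : Prop :=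
  ∀ K : Set E, IsCompact K → ∃ F : Finset ι, (∀ j ∉ F, ∀ x ∈ K, s j x = 0) ∧
    ∀ x ∈ K, ∑ j ∈ F, s j x = 1

theorem hasSum_toTemperedDistribution {ι : Type*} {r : ℝ≥0∞} [Fact (1 ≤ r)]
    {u : ι → Lp ℂ r (volume : Measure E)} {v : Lp ℂ r (volume : Measure E)} (hu : HasSum u v)
    (ψ : 𝓢(E, ℂ)) :
    HasSum (fun j => Lp.toTemperedDistribution (u j) ψ) (Lp.toTemperedDistribution v ψ) := by
  have h1 := hu.mapL (Lp.toTemperedDistributionCLM ℂ (volume : Measure E) r)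
  exact h1.mapL (PointwiseConvergenceCLM.evalCLM (RingHom.id ℂ) ℂ ψ)

/-- Tested against 𝓕 φ with φ compactly supported, the series is a finite sum whose symbols add up
to 1 on supp φ. The exponents p and r differ because the pieces of the second factor of a product
are summed in L^∞. -/
theorem IsFrequencyPartition.tsum_ae_eq {ι : Type*} {s : ι → 𝓢(E, ℂ)}
    (hs : IsFrequencyPartition s) {p r : ℝ≥0∞} [Fact (1 ≤ p)] [Fact (1 ≤ r)]
    (f : Lp ℂ p (volume : Measure E)) {u : ι → Lp ℂ r (volume : Measure E)}
    {v : Lp ℂ r (volume : Measure E)} (hu : HasSum u v)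
    (hus : ∀ j, Lp.toTemperedDistribution (u j) =
      TemperedDistribution.fourierMultiplierCLM ℂ (s j) (Lp.toTemperedDistribution f)) :
    v =ᵐ[volume] f := by
  have hd : (fun x => v x - f x) =ᵐ[volume] 0 := by
    refine ae_eq_zero_of_integral_fourier_mul_eq_zero (fun ψ => ?_) fun φ hφ => ?_
    · simp only [mul_sub]
      exact (integrable_schwartz_mul ψ v).sub (integrable_schwartz_mul ψ f)
    · simp only [mul_sub]
      rw [integral_sub (integrable_schwartz_mul _ v) (integrable_schwartz_mul _ f), sub_eq_zero]
      have e1 := Lp.toTemperedDistribution_apply v (𝓕 φ)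
      have e2 := Lp.toTemperedDistribution_apply f (𝓕 φ)
      simp only [smul_eq_mul] at e1 e2
      rw [← e1, ← e2]
      obtain ⟨F, hF0, hF1⟩ := hs _ hφ
      have hterm : ∀ j, Lp.toTemperedDistribution (u j) (𝓕 φ) =
          Lp.toTemperedDistribution f (𝓕 (SchwartzMap.smulLeftCLM ℂ (s j) φ)) := by
        intro j
        rw [hus, TemperedDistribution.fourierMultiplierCLM_apply_apply,
          FourierTransform.fourierInv_fourier_eq]
      have hz : ∀ j ∉ F, Lp.toTemperedDistribution (u j) (𝓕 φ) = 0 := by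
        intro j hj
        have : SchwartzMap.smulLeftCLM ℂ (s j) φ = 0 := by
          ext x
          rw [SchwartzMap.smulLeftCLM_apply_apply (SchwartzMap.hasTemperateGrowth _)]
          by_cases hx : x ∈ tsupport φ
          · simp [hF0 j hj x hx]
          · simp [image_eq_zero_of_notMem_tsupport hx]
        rw [hterm, this, FourierTransform.fourier_zero, map_zero]
      have hsum : ∑ j ∈ F, Lp.toTemperedDistribution (u j) (𝓕 φ) =
          Lp.toTemperedDistribution f (𝓕 φ) := by
        simp only [hterm]
        rw [← map_sum, ← FourierTransform.fourier_sum]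
        congr 2
        ext x
        simp only [sum_apply,
          SchwartzMap.smulLeftCLM_apply_apply (SchwartzMap.hasTemperateGrowth _)]
        rw [← Finset.sum_smul]
        by_cases hx : x ∈ tsupport φ
        · rw [hF1 x hx, one_smul]
        · simp [image_eq_zero_of_notMem_tsupport hx]
      exact (hasSum_toTemperedDistribution hu (𝓕 φ)).unique (hsum ▸ hasSum_sum_of_ne_finset_zero hz)
  filter_upwards [hd] with x hx
  exact sub_eq_zero.1 hx

end Spectrum

noncomputable section

/-! ## The symbols of the frequency-uniform decomposition -/

section Sigma

variable {n : ℕ}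

/-- The lattice points with coordinates of absolute value at most `N`. -/
def latticeBox (n N : ℕ) : Finset (Fin n → ℤ) :=
  Fintype.piFinset fun _ => Finset.Icc (-(N : ℤ)) N

theorem mem_latticeBox {N : ℕ} {k : Fin n → ℤ} : k ∈ latticeBox n N ↔ ∀ i, |(k i : ℝ)| ≤ N := by
  simp only [latticeBox, Fintype.mem_piFinset, Finset.mem_Icc, abs_le]
  exact forall_congr' fun i => by norm_cast

@[simp] theorem latticePoint_apply (k : Fin n → ℤ) (i : Fin n) : latticePoint k i = k i := rfl

theorem latticePoint_sub (k m : Fin n → ℤ) :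
    latticePoint (k - m) = latticePoint k - latticePoint m := by
  ext i; simp

variable {ρ : EuclideanSpace ℝ (Fin n) → ℝ}

theorem IsWindow.abs_le_one (hρ : IsWindow ρ) {ξ : EuclideanSpace ℝ (Fin n)} (h : ρ ξ ≠ 0)
    (i : Fin n) : |ξ i| ≤ 1 :=
  hρ.support (subset_tsupport ρ h) i

theorem IsWindow.mem_latticeBox (hρ : IsWindow ρ) {ξ : EuclideanSpace ℝ (Fin n)} {N : ℕ}
    (hξ : ∀ i, |ξ i| ≤ N) {m : Fin n → ℤ} (h : ρ (ξ - latticePoint m) ≠ 0) :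
    m ∈ latticeBox n (N + 1) := by
  rw [UltraModulation.mem_latticeBox]
  intro i
  have h1 := hρ.abs_le_one h i
  have h2 := hξ i
  simp only [PiLp.sub_apply, latticePoint_apply] at h1
  rw [abs_le] at h1 h2 ⊢
  push_cast
  constructor <;> linarith [h1.1, h1.2, h2.1, h2.2]

theorem IsWindow.tsum_eq_sum (hρ : IsWindow ρ) {ξ : EuclideanSpace ℝ (Fin n)} {N : ℕ}
    (hξ : ∀ i, |ξ i| ≤ N) :
    ∑' m, ρ (ξ - latticePoint m) = ∑ m ∈ latticeBox n (N + 1), ρ (ξ - latticePoint m) :=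
  _root_.tsum_eq_sum fun _ hm => by_contra fun h => hm (hρ.mem_latticeBox hξ h)

theorem exists_nat_forall_abs_lt (ξ : EuclideanSpace ℝ (Fin n)) :
    ∃ N : ℕ, ∀ i, |ξ i| < N := by
  obtain ⟨N, hN⟩ := exists_nat_gt ‖ξ‖
  exact ⟨N, fun i => (by simpa using PiLp.norm_apply_le ξ i : |ξ i| ≤ ‖ξ‖).trans_lt hN⟩

theorem isOpen_forall_abs_lt (N : ℝ) : IsOpen {ξ : EuclideanSpace ℝ (Fin n) | ∀ i, |ξ i| < N} := by
  simp only [ofPred_forall]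
  exact isOpen_iInter_of_finite fun i => isOpen_lt (by fun_prop) continuous_const

theorem IsWindow.contDiff_tsum (hρ : IsWindow ρ) :
    ContDiff ℝ ∞ fun ξ => ∑' m, ρ (ξ - latticePoint m) := by
  rw [contDiff_iff_contDiffAt]
  intro ξ
  obtain ⟨N, hN⟩ := exists_nat_forall_abs_lt ξ
  have hs : ContDiff ℝ ∞ fun ξ => ∑ m ∈ latticeBox n (N + 1), ρ (ξ - latticePoint m) :=
    ContDiff.sum fun m _ => hρ.smooth.comp (contDiff_id.sub contDiff_const)
  refine hs.contDiffAt.congr_of_eventuallyEq ?_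
  filter_upwards [(isOpen_forall_abs_lt (N : ℝ)).mem_nhds hN] with ζ hζ
  exact hρ.tsum_eq_sum fun i => (hζ i).le

theorem IsWindow.tsum_pos (hρ : IsWindow ρ) (ξ : EuclideanSpace ℝ (Fin n)) :
    0 < ∑' m, ρ (ξ - latticePoint m) := by
  obtain ⟨N, hN⟩ := exists_nat_forall_abs_lt ξ
  rw [hρ.tsum_eq_sum fun i => (hN i).le]
  have h1 : ρ (ξ - latticePoint fun i => round (ξ i)) = 1 :=
    hρ.eq_one _ fun i => by simpa using abs_sub_round (ξ i)
  refine Finset.sum_pos' (fun m _ => hρ.nonneg _) ⟨fun i => round (ξ i), ?_, by rw [h1]; norm_num⟩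
  exact hρ.mem_latticeBox (fun i => (hN i).le) (by rw [h1]; norm_num)

theorem IsWindow.contDiff_sigma (hρ : IsWindow ρ) (k : Fin n → ℤ) :
    ContDiff ℝ ∞ (sigma ρ k) :=
  (hρ.smooth.comp (contDiff_id.sub contDiff_const)).div hρ.contDiff_tsum
    fun ξ => (hρ.tsum_pos ξ).ne'

theorem IsWindow.abs_sub_le_of_sigma_ne_zero (hρ : IsWindow ρ) {k : Fin n → ℤ}
    {ξ : EuclideanSpace ℝ (Fin n)} (h : sigma ρ k ξ ≠ 0) (i : Fin n) : |ξ i - k i| ≤ 1 := by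
  have : ρ (ξ - latticePoint k) ≠ 0 := fun h0 => h (by simp [sigma, h0])
  simpa using hρ.abs_le_one this i

theorem sigma_sub_latticePoint (k m : Fin n → ℤ) (ξ : EuclideanSpace ℝ (Fin n)) :
    sigma ρ k (ξ - latticePoint m) = sigma ρ (k + m) ξ := by
  have e : ∀ j, ξ - latticePoint m - latticePoint j = ξ - latticePoint (j + m) := by
    intro j; ext i; simp; ring
  simp only [sigma, e]
  congr 1
  exact (Equiv.addRight m).tsum_eq fun j => ρ (ξ - latticePoint j)

theorem IsWindow.sum_sigma (hρ : IsWindow ρ) {ξ : EuclideanSpace ℝ (Fin n)}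
    {S : Finset (Fin n → ℤ)} (hS : ∀ k, sigma ρ k ξ ≠ 0 → k ∈ S) : ∑ k ∈ S, sigma ρ k ξ = 1 := by
  have h0 := (hρ.tsum_pos ξ).ne'
  have h1 : ∑' m, ρ (ξ - latticePoint m) = ∑ m ∈ S, ρ (ξ - latticePoint m) := by
    refine _root_.tsum_eq_sum fun m hm => by_contra fun h => hm (hS m ?_)
    exact div_ne_zero h h0
  simp only [sigma]
  rw [← Finset.sum_div, ← h1, div_self h0]

/-- The symbol `η ↦ σ_k(2πη)` as a Schwartz function. -/
def boxSymbol (hρ : IsWindow ρ) (k : Fin n → ℤ) : 𝓢(EuclideanSpace ℝ (Fin n), ℂ) :=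
  HasCompactSupport.toSchwartzMap (f := fun η => ((sigma ρ k ((2 * Real.pi) • η) : ℝ) : ℂ))
    (by
      refine HasCompactSupport.of_support_subset_isCompact
        (isCompact_closedBall (0 : EuclideanSpace ℝ (Fin n)) (n * (‖latticePoint k‖ + 1))) ?_
      intro η hη
      have hη' : sigma ρ k ((2 * Real.pi) • η) ≠ 0 := by simpa using hη
      rw [mem_closedBall_zero_iff, EuclideanSpace.norm_eq]
      have hb : ∀ i, ‖η i‖ ≤ ‖latticePoint k‖ + 1 := by
        intro i
        have h1 := hρ.abs_sub_le_of_sigma_ne_zero hη' i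
        have h2 := abs_le_norm_latticePoint k i
        simp only [PiLp.smul_apply, smul_eq_mul] at h1
        have h3 : |2 * Real.pi * η i| ≤ ‖latticePoint k‖ + 1 := by
          rw [abs_le] at h1 h2 ⊢
          constructor <;> linarith [h1.1, h1.2, h2.1, h2.2]
        rw [abs_mul, abs_of_pos (by positivity)] at h3
        rw [Real.norm_eq_abs]
        nlinarith [Real.pi_gt_three, abs_nonneg (η i)]
      rw [Real.sqrt_le_left (by positivity)]
      calc ∑ i, ‖η i‖ ^ 2 ≤ ∑ _i : Fin n, (‖latticePoint k‖ + 1) ^ 2 :=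
            Finset.sum_le_sum fun i _ => pow_le_pow_left₀ (norm_nonneg _) (hb i) 2
        _ = n * (‖latticePoint k‖ + 1) ^ 2 := by simp
        _ ≤ (n * (‖latticePoint k‖ + 1)) ^ 2 := by
            rw [mul_pow]
            gcongr
            have : (n : ℝ) ≤ ((n ^ 2 : ℕ) : ℝ) := by
              exact_mod_cast Nat.le_self_pow (by norm_num) n
            simpa using this)
    (Complex.ofRealCLM.contDiff.comp ((hρ.contDiff_sigma k).comp (contDiff_const_smul _)))

theorem boxSymbol_apply (hρ : IsWindow ρ) (k : Fin n → ℤ) (η : EuclideanSpace ℝ (Fin n)) :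
    boxSymbol hρ k η = (sigma ρ k ((2 * Real.pi) • η) : ℂ) := rfl

theorem hasCompactSupport_boxSymbol (hρ : IsWindow ρ) (k : Fin n → ℤ) :
    HasCompactSupport (boxSymbol hρ k) := by
  unfold boxSymbol
  generalize_proofs h1 h2
  exact h1

theorem abs_sub_le_of_boxSymbol_ne_zero (hρ : IsWindow ρ) {k : Fin n → ℤ}
    {η : EuclideanSpace ℝ (Fin n)} (h : boxSymbol hρ k η ≠ 0) (i : Fin n) :
    |2 * Real.pi * η i - k i| ≤ 1 := by
  have : sigma ρ k ((2 * Real.pi) • η) ≠ 0 := by simpa [boxSymbol_apply] using h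
  simpa using hρ.abs_sub_le_of_sigma_ne_zero this i

theorem tsupport_boxSymbol_subset (hρ : IsWindow ρ) (k : Fin n → ℤ) :
    tsupport (boxSymbol hρ k) ⊆ {η | ∀ i, |2 * Real.pi * η i - k i| ≤ 1} := by
  refine closure_minimal (fun η hη i => abs_sub_le_of_boxSymbol_ne_zero hρ hη i) ?_
  simp only [ofPred_forall]
  exact isClosed_iInter fun i => isClosed_le (by fun_prop) continuous_const

theorem sum_boxSymbol (hρ : IsWindow ρ) {η : EuclideanSpace ℝ (Fin n)}
    {S : Finset (Fin n → ℤ)} (hS : ∀ k, boxSymbol hρ k η ≠ 0 → k ∈ S) :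
    ∑ k ∈ S, boxSymbol hρ k η = 1 := by
  have := hρ.sum_sigma (ξ := (2 * Real.pi) • η) (S := S) fun k hk => hS k (by
    simpa [boxSymbol_apply] using hk)
  simp only [boxSymbol_apply]
  exact_mod_cast this

theorem isFrequencyPartition_boxSymbol (hρ : IsWindow ρ) :
    IsFrequencyPartition (boxSymbol hρ) := by
  intro K hK
  obtain ⟨C, hC⟩ := hK.isBounded.exists_norm_le
  obtain ⟨N, hN⟩ := exists_nat_ge (2 * Real.pi * C + 1)
  have key : ∀ η ∈ K, ∀ k, boxSymbol hρ k η ≠ 0 → k ∈ latticeBox n N := by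
    intro η hη k hk
    rw [mem_latticeBox]
    intro i
    have h1 := abs_sub_le_of_boxSymbol_ne_zero hρ hk i
    have h2 : |η i| ≤ C := (by simpa using PiLp.norm_apply_le η i : |η i| ≤ ‖η‖).trans (hC η hη)
    have h3 : |2 * Real.pi * η i| ≤ 2 * Real.pi * C := by
      rw [abs_mul, abs_of_pos (by positivity)]
      gcongr
    rw [abs_le] at h1 h3 ⊢
    constructor <;> linarith [h1.1, h1.2, h3.1, h3.2]
  exact ⟨latticeBox n N, fun j hj η hη => by_contra fun h => hj (key η hη j h),
    fun η hη => sum_boxSymbol hρ (key η hη)⟩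

/-- The symbols are translates of one another, so their kernels differ by a phase. This makes every
operator bound below uniform in k. -/
theorem norm_fourierInv_boxSymbol (hρ : IsWindow ρ) (k : Fin n → ℤ)
    (x : EuclideanSpace ℝ (Fin n)) :
    ‖(𝓕⁻ (boxSymbol hρ k)) x‖ = ‖(𝓕⁻ (boxSymbol hρ 0)) x‖ := by
  set y : EuclideanSpace ℝ (Fin n) := (2 * Real.pi)⁻¹ • latticePoint k with hy
  have e : ⇑(boxSymbol hρ k) = fun η => boxSymbol hρ 0 (η - y) := by
    ext η
    rw [boxSymbol_apply, boxSymbol_apply, smul_sub, hy, smul_smul,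
      mul_inv_cancel₀ (by positivity), one_smul, sigma_sub_latticePoint, zero_add]
  have h := fourier_char_smul_comp_sub (⇑(boxSymbol hρ 0)) y 0 (-x)
  simp only [inner_zero_right, AddChar.map_zero_eq_one, one_smul, sub_zero] at h
  rw [SchwartzMap.fourierInv_coe, SchwartzMap.fourierInv_coe, Real.fourierInv_eq_fourier_neg,
    Real.fourierInv_eq_fourier_neg, e, h, Circle.norm_smul]

theorem eLpNorm_fourierInv_boxSymbol (hρ : IsWindow ρ) (k : Fin n → ℤ) (r : ℝ≥0∞) :
    eLpNorm (𝓕⁻ (boxSymbol hρ k) : 𝓢(EuclideanSpace ℝ (Fin n), ℂ)) r volume =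
      eLpNorm (𝓕⁻ (boxSymbol hρ 0) : 𝓢(EuclideanSpace ℝ (Fin n), ℂ)) r volume :=
  eLpNorm_congr_norm_ae (ae_of_all _ (norm_fourierInv_boxSymbol hρ k))

end Sigma

/-! ## Band-limited pieces -/

section Pieces

variable {n : ℕ} {ρ : EuclideanSpace ℝ (Fin n) → ℝ} {p : ℝ≥0∞} [hp : Fact (1 ≤ p)]

theorem exists_enorm_boxLp_le (hρ : IsWindow ρ) (p : ℝ≥0∞) [Fact (1 ≤ p)] :
    ∃ C : ℝ≥0∞, C ≠ ⊤ ∧ ∀ (k : Fin n → ℤ) (f : Lp ℂ p (volume : Measure (EuclideanSpace ℝ (Fin n)))),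
      ‖multiplierLp (boxSymbol hρ k) f‖ₑ ≤ C * ‖f‖ₑ := by
  refine ⟨_, schwartz_eLpNorm_ne_top (𝓕⁻ (boxSymbol hρ 0)) 1, fun k f => ?_⟩
  rw [← eLpNorm_fourierInv_boxSymbol hρ k]
  exact enorm_multiplierLp_le _ f

theorem fourierMultiplierCLM_eq_of_smulLeft {E : Type*} [NormedAddCommGroup E]
    [InnerProductSpace ℝ E] [FiniteDimensional ℝ E] [MeasurableSpace E] [BorelSpace E]
    (T : 𝓢'(E, ℂ)) {a b : E → ℂ}
    (h : ∀ φ : 𝓢(E, ℂ), 𝓕 T (SchwartzMap.smulLeftCLM ℂ a φ) =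
      𝓕 T (SchwartzMap.smulLeftCLM ℂ b φ)) :
    TemperedDistribution.fourierMultiplierCLM ℂ a T =
      TemperedDistribution.fourierMultiplierCLM ℂ b T := by
  ext φ
  rw [TemperedDistribution.fourierMultiplierCLM_apply_apply,
    TemperedDistribution.fourierMultiplierCLM_apply_apply]
  exact h (𝓕⁻ φ)

/-- Reproducing formula: two symbols overlap only if their centres differ by at most 2 in each
coordinate, so the neighbours of k sum to 1 on the support of the k-th symbol. -/
theorem multiplierTop_boxSymbol_eq_sum (hρ : IsWindow ρ) (k : Fin n → ℤ)
    (f : Lp ℂ p (volume : Measure (EuclideanSpace ℝ (Fin n)))) :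
    multiplierTop (boxSymbol hρ k) f = ∑ m ∈ latticeBox n 2,
      multiplierTop (boxSymbol hρ (k + m)) (multiplierLp (boxSymbol hρ k) f) := by
  apply toTemperedDistribution_injective
  have hlin : Lp.toTemperedDistribution (∑ m ∈ latticeBox n 2,
      multiplierTop (boxSymbol hρ (k + m)) (multiplierLp (boxSymbol hρ k) f)) =
      ∑ m ∈ latticeBox n 2, Lp.toTemperedDistribution
        (multiplierTop (boxSymbol hρ (k + m)) (multiplierLp (boxSymbol hρ k) f)) :=
    map_sum (Lp.toTemperedDistributionCLM ℂ
      (volume : Measure (EuclideanSpace ℝ (Fin n))) ⊤) _ _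
  rw [hlin]
  simp only [toTemperedDistribution_multiplierTop, toTemperedDistribution_multiplierLp]
  simp only [TemperedDistribution.fourierMultiplierCLM_fourierMultiplierCLM_apply
    (SchwartzMap.hasTemperateGrowth _) (SchwartzMap.hasTemperateGrowth _)]
  have hT : ∀ m, ((boxSymbol hρ k : EuclideanSpace ℝ (Fin n) → ℂ) *
      boxSymbol hρ (k + m)).HasTemperateGrowth := fun m =>
    (SchwartzMap.hasTemperateGrowth _).mul (SchwartzMap.hasTemperateGrowth _)
  rw [← sum_apply, ← TemperedDistribution.fourierMultiplierCLM_sum ℂ fun m _ => hT m]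
  congr 2
  ext η
  simp only [Pi.mul_apply]
  rw [← Finset.mul_sum]
  by_cases h0 : boxSymbol hρ k η = 0
  · simp [h0]
  · have h1 : ∑ m ∈ latticeBox n 2, boxSymbol hρ (k + m) η = 1 := by
      have := sum_boxSymbol hρ (η := η) (S := (latticeBox n 2).map (addLeftEmbedding k)) ?_
      · rw [← this, Finset.sum_map]
        rfl
      · intro j hj
        rw [Finset.mem_map]
        refine ⟨j - k, ?_, by simp⟩
        rw [mem_latticeBox]
        intro i
        have h2 := abs_sub_le_of_boxSymbol_ne_zero hρ hj i
        have h3 := abs_sub_le_of_boxSymbol_ne_zero hρ h0 i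
        rw [abs_le] at h2 h3 ⊢
        simp only [Pi.sub_apply, Int.cast_sub, Nat.cast_ofNat]
        constructor <;> linarith [h2.1, h2.2, h3.1, h3.2]
    rw [h1, mul_one]

/-- Bernstein's inequality: by the reproducing formula, the L^p to L^∞ bound is applied to the piece
itself rather than to f. -/
theorem exists_enorm_boxTop_le (hρ : IsWindow ρ) (p : ℝ≥0∞) [Fact (1 ≤ p)] :
    ∃ C : ℝ≥0∞, C ≠ ⊤ ∧ ∀ (k : Fin n → ℤ) (f : Lp ℂ p (volume : Measure (EuclideanSpace ℝ (Fin n)))),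
      ‖multiplierTop (boxSymbol hρ k) f‖ₑ ≤ C * ‖multiplierLp (boxSymbol hρ k) f‖ₑ := by
  refine ⟨(latticeBox n 2).card * eLpNorm (𝓕⁻ (boxSymbol hρ 0) :
    𝓢(EuclideanSpace ℝ (Fin n), ℂ)) (1 - p⁻¹)⁻¹ volume,
    ENNReal.mul_ne_top (ENNReal.natCast_ne_top _) (schwartz_eLpNorm_ne_top _ _), fun k f => ?_⟩
  rw [multiplierTop_boxSymbol_eq_sum]
  refine (enorm_sum_le _ _).trans ?_
  refine (Finset.sum_le_sum fun m _ => enorm_multiplierTop_le _ _).trans_eq ?_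
  simp only [eLpNorm_fourierInv_boxSymbol hρ, Finset.sum_const, nsmul_eq_mul, mul_assoc]

theorem multiplierLp_box_eq_zero_of_disjoint (hρ : IsWindow ρ) (k : Fin n → ℤ)
    (f : Lp ℂ p (volume : Measure (EuclideanSpace ℝ (Fin n))))
    (hd : Disjoint (tsupport (boxSymbol hρ k))
      (Distribution.dsupport
        (𝓕 (Lp.toTemperedDistribution f) : 𝓢'(EuclideanSpace ℝ (Fin n), ℂ)))) :
    multiplierLp (boxSymbol hρ k) f = 0 := by
  apply toTemperedDistribution_injective
  rw [toTemperedDistribution_multiplierLp]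
  have h0 : Lp.toTemperedDistribution (0 : Lp ℂ p (volume : Measure (EuclideanSpace ℝ (Fin n)))) =
      0 := map_zero (Lp.toTemperedDistributionCLM ℂ
        (volume : Measure (EuclideanSpace ℝ (Fin n))) p)
  rw [h0]
  ext φ
  rw [TemperedDistribution.fourierMultiplierCLM_apply_apply]
  have hsub := SchwartzMap.tsupport_smulLeftCLM_subset (boxSymbol hρ k) (𝓕⁻ φ)
  exact apply_eq_zero_of_disjoint_dsupport (𝓕 (Lp.toTemperedDistribution f)) _
    ((hasCompactSupport_boxSymbol hρ k).of_isClosed_subset (isClosed_tsupport _)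
      (hsub.trans inter_subset_right)) (hd.mono_left (hsub.trans inter_subset_right))

end Pieces

end

noncomputable section

/-! ## Products of band-limited functions -/

section Product

variable {E : Type*} [NormedAddCommGroup E] [InnerProductSpace ℝ E] [FiniteDimensional ℝ E]
  [MeasurableSpace E] [BorelSpace E] {p : ℝ≥0∞} [hp : Fact (1 ≤ p)]

/-- Pointwise multiplication `L^p × L^∞ → L^p`. -/
def lpMul : Lp ℂ p (volume : Measure E) →L[ℂ] Lp ℂ ⊤ (volume : Measure E) →L[ℂ]
    Lp ℂ p (volume : Measure E) :=
  (ContinuousLinearMap.mul ℂ ℂ).holderL volume p ⊤ p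

theorem coeFn_lpMul (u : Lp ℂ p (volume : Measure E)) (v : Lp ℂ ⊤ (volume : Measure E)) :
    lpMul u v =ᵐ[volume] fun x => u x * v x :=
  (ContinuousLinearMap.mul ℂ ℂ).coeFn_holder (r := p) u v

theorem enorm_lpMul_le (u : Lp ℂ p (volume : Measure E)) (v : Lp ℂ ⊤ (volume : Measure E)) :
    ‖lpMul u v‖ₑ ≤ ‖u‖ₑ * ‖v‖ₑ := by
  have h := (ContinuousLinearMap.mul ℂ ℂ).norm_holder_apply_apply_le (r := p) u v
  have h1 : ‖lpMul u v‖ ≤ ‖u‖ * ‖v‖ := by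
    refine h.trans ?_
    have := ContinuousLinearMap.opNorm_mul_le ℂ ℂ
    calc _ ≤ 1 * ‖u‖ * ‖v‖ := by gcongr
      _ = _ := by rw [one_mul]
  rw [← ofReal_norm, ← ofReal_norm, ← ofReal_norm, ← ENNReal.ofReal_mul (norm_nonneg _)]
  exact ENNReal.ofReal_le_ofReal h1

theorem toTemperedDistribution_lpMul_fourier (a b φ : 𝓢(E, ℂ))
    (f g : Lp ℂ p (volume : Measure E)) :
    Lp.toTemperedDistribution (lpMul (multiplierLp a f) (multiplierTop b g)) (𝓕 φ) =
      ∫ x, 𝓕 φ x * (kernelConv (𝓕⁻ a) f x * kernelConv (𝓕⁻ b) g x) := by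
  rw [Lp.toTemperedDistribution_apply]
  refine integral_congr_ae ?_
  filter_upwards [coeFn_lpMul (multiplierLp a f) (multiplierTop b g), coeFn_multiplierLp a f,
    coeFn_multiplierTop b g] with x h1 h2 h3
  rw [h1, h2, h3, smul_eq_mul]

theorem multiplierLp_lpMul_eq_zero (a b c : 𝓢(E, ℂ)) (f g : Lp ℂ p (volume : Measure E))
    (h : ∀ ξ η, a ξ ≠ 0 → b η ≠ 0 → c (ξ + η) = 0) :
    multiplierLp c (lpMul (multiplierLp a f) (multiplierTop b g)) = 0 := by
  apply toTemperedDistribution_injective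
  rw [toTemperedDistribution_multiplierLp]
  have h0 : Lp.toTemperedDistribution (0 : Lp ℂ p (volume : Measure E)) = 0 :=
    map_zero (Lp.toTemperedDistributionCLM ℂ (volume : Measure E) p)
  rw [h0]
  ext φ
  rw [TemperedDistribution.fourierMultiplierCLM_apply_apply,
    toTemperedDistribution_lpMul_fourier,
    integral_fourier_mul_kernelConv_mul_kernelConv _ _ _ _ _ fun ξ η ha hb => ?_]
  · rfl
  · rw [SchwartzMap.smulLeftCLM_apply_apply (SchwartzMap.hasTemperateGrowth _), h ξ η ha hb,
      zero_smul]

/-- Take a = χ b with χ equal to 1 near the spectrum of T and 0 off its r-neighbourhood: the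
difference (χ-1) b φ is supported away from the spectrum. This localises to the spectrum of the
function instead of the support of the symbol. -/
theorem exists_multiplier_near_dsupport (T : 𝓢'(E, ℂ)) {b : 𝓢(E, ℂ)} (hb : HasCompactSupport b)
    {r : ℝ} (hr : 0 < r) : ∃ a : 𝓢(E, ℂ),
      TemperedDistribution.fourierMultiplierCLM ℂ a T =
        TemperedDistribution.fourierMultiplierCLM ℂ b T ∧
      ∀ ξ, a ξ ≠ 0 → ∃ y ∈ Distribution.dsupport (𝓕 T : 𝓢'(E, ℂ)), dist ξ y < r := by
  set A := Distribution.dsupport (𝓕 T : 𝓢'(E, ℂ)) with hA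
  have hAc : IsClosed A := Distribution.isClosed_dsupport
  obtain ⟨χ, h1, h2, -⟩ := exists_contMDiffMap_one_nhds_of_subset_interior
    (n := (⊤ : ℕ∞)) (modelWithCornersSelf ℝ E) hAc
    (Metric.self_subset_thickening hr A |>.trans_eq Metric.isOpen_thickening.interior_eq.symm)
  have hχ : ContDiff ℝ ∞ χ := contMDiff_iff_contDiff.1 χ.contMDiff
  have hs : ContDiff ℝ ∞ fun ξ => (χ ξ : ℂ) * b ξ :=
    (Complex.ofRealCLM.contDiff.comp hχ).mul (b.smooth ⊤)
  have hc : HasCompactSupport fun ξ => (χ ξ : ℂ) * b ξ := hb.mul_left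
  refine ⟨hc.toSchwartzMap hs, fourierMultiplierCLM_eq_of_smulLeft T fun φ => ?_, fun ξ hξ => ?_⟩
  · rw [← sub_eq_zero, ← map_sub]
    set ψ := SchwartzMap.smulLeftCLM ℂ (hc.toSchwartzMap hs) φ - SchwartzMap.smulLeftCLM ℂ b φ
      with hψ
    have hψx : ∀ ξ, ψ ξ = ((χ ξ : ℂ) - 1) * (b ξ * φ ξ) := by
      intro ξ
      rw [hψ, sub_apply,
        SchwartzMap.smulLeftCLM_apply_apply (SchwartzMap.hasTemperateGrowth _),
        SchwartzMap.smulLeftCLM_apply_apply (SchwartzMap.hasTemperateGrowth _),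
        HasCompactSupport.toSchwartzMap_toFun]
      simp only [smul_eq_mul]
      ring
    have hsupp : HasCompactSupport ψ := by
      have e : (ψ : E → ℂ) = fun ξ => ((χ ξ : ℂ) - 1) * (b ξ * φ ξ) := funext hψx
      rw [e]
      exact (hb.mul_right).mul_left
    refine apply_eq_zero_of_disjoint_dsupport _ ψ hsupp ?_
    rw [Set.disjoint_right]
    intro x hx
    rw [notMem_tsupport_iff_eventuallyEq]
    have := (eventually_nhdsSet_iff_forall.1 h1) x hx
    filter_upwards [this] with ξ hξ
    rw [hψx, hξ]
    simp
  · have : χ ξ ≠ 0 := by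
      intro h0
      exact hξ (by rw [HasCompactSupport.toSchwartzMap_toFun]; simp [h0])
    have : ξ ∈ Metric.thickening r A := by_contra fun h => this (h2 ξ h)
    exact Metric.mem_thickening_iff.1 this

theorem multiplierLp_congr {a b : 𝓢(E, ℂ)} {f : Lp ℂ p (volume : Measure E)}
    (h : TemperedDistribution.fourierMultiplierCLM ℂ a (Lp.toTemperedDistribution f) =
      TemperedDistribution.fourierMultiplierCLM ℂ b (Lp.toTemperedDistribution f)) :
    multiplierLp a f = multiplierLp b f := by
  apply toTemperedDistribution_injective
  rw [toTemperedDistribution_multiplierLp, toTemperedDistribution_multiplierLp, h]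

theorem multiplierTop_congr {a b : 𝓢(E, ℂ)} {f : Lp ℂ p (volume : Measure E)}
    (h : TemperedDistribution.fourierMultiplierCLM ℂ a (Lp.toTemperedDistribution f) =
      TemperedDistribution.fourierMultiplierCLM ℂ b (Lp.toTemperedDistribution f)) :
    multiplierTop a f = multiplierTop b f := by
  apply toTemperedDistribution_injective
  rw [toTemperedDistribution_multiplierTop, toTemperedDistribution_multiplierTop, h]

/-- Each factor is replaced by one with symbol within r of its spectrum. The sum of frequencies
moves by less than 2r, and φ lives within r of x; hence the distance 3r. -/
theorem toTemperedDistribution_lpMul_fourier_eq_zero (f g : Lp ℂ p (volume : Measure E))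
    {a b : 𝓢(E, ℂ)} (ha : HasCompactSupport a) (hb : HasCompactSupport b) {x : E} {r : ℝ}
    (hr : 0 < r)
    (hx : ∀ ξ ∈ Distribution.dsupport (𝓕 (Lp.toTemperedDistribution f) : 𝓢'(E, ℂ)),
      ∀ η ∈ Distribution.dsupport (𝓕 (Lp.toTemperedDistribution g) : 𝓢'(E, ℂ)),
        3 * r ≤ dist (ξ + η) x)
    {φ : 𝓢(E, ℂ)} (hφ : tsupport φ ⊆ Metric.ball x r) :
    Lp.toTemperedDistribution (lpMul (multiplierLp a f) (multiplierTop b g)) (𝓕 φ) = 0 := by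
  obtain ⟨a', ha', ha's⟩ := exists_multiplier_near_dsupport (Lp.toTemperedDistribution f) ha hr
  obtain ⟨b', hb', hb's⟩ := exists_multiplier_near_dsupport (Lp.toTemperedDistribution g) hb hr
  rw [← multiplierLp_congr ha', ← multiplierTop_congr hb', toTemperedDistribution_lpMul_fourier]
  refine integral_fourier_mul_kernelConv_mul_kernelConv _ _ _ _ _ fun ξ η hξ hη => ?_
  by_contra h
  obtain ⟨y, hy, hyr⟩ := ha's ξ hξ
  obtain ⟨z, hz, hzr⟩ := hb's η hη
  have h1 : dist (ξ + η) x < r := hφ (subset_tsupport φ h)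
  have h2 := hx y hy z hz
  have h3 : dist (y + z) (ξ + η) ≤ dist y ξ + dist z η := dist_add_add_le _ _ _ _
  have h4 := dist_triangle (y + z) (ξ + η) x
  rw [dist_comm] at hyr hzr
  linarith

/-- The product of two functions with absolutely convergent frequency decompositions. -/
theorem IsFrequencyPartition.exists_product {ι : Type*} {s : ι → 𝓢(E, ℂ)}
    (hs : IsFrequencyPartition s) (f g : Lp ℂ p (volume : Measure E))
    (hf : Summable fun j => ‖multiplierLp (s j) f‖)
    (hg : Summable fun j => ‖multiplierTop (s j) g‖) :
    ∃ P : Lp ℂ p (volume : Measure E), (P : E →ₘ[volume] ℂ) = f * g ∧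
      ∃ Q : ι → Lp ℂ p (volume : Measure E),
        (∀ j, HasSum (fun l => lpMul (multiplierLp (s j) f) (multiplierTop (s l) g)) (Q j)) ∧
        HasSum Q P := by
  obtain ⟨u, hu⟩ := hf.of_norm
  obtain ⟨v, hv⟩ := hg.of_norm
  have hu' : u =ᵐ[volume] f := hs.tsum_ae_eq f hu fun j => toTemperedDistribution_multiplierLp _ f
  have hv' : v =ᵐ[volume] g := hs.tsum_ae_eq g hv fun j => toTemperedDistribution_multiplierTop _ g
  -- Continuity in one factor at a time suffices: summing over l gives □_j f · v, and then summing
  -- over j gives u · v.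
  refine ⟨lpMul u v, ?_, fun j => lpMul (multiplierLp (s j) f) v, fun j => hv.mapL _, ?_⟩
  · refine AEEqFun.ext ?_
    filter_upwards [coeFn_lpMul u v, hu', hv', AEEqFun.coeFn_mul (f : E →ₘ[volume] ℂ) g]
      with x h1 h2 h3 h4
    rw [h1, h2, h3, h4, Pi.mul_apply]
  · exact hu.mapL (lpMul.flip v)

theorem dsupport_product_subset {ι : Type*} {s : ι → 𝓢(E, ℂ)}
    (hsc : ∀ j, HasCompactSupport (s j)) {f g P : Lp ℂ p (volume : Measure E)}
    {Q : ι → Lp ℂ p (volume : Measure E)}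
    (hQ : ∀ j, HasSum (fun l => lpMul (multiplierLp (s j) f) (multiplierTop (s l) g)) (Q j))
    (hP : HasSum Q P) {K : Set E} (hK : IsClosed K)
    (hsub : ∀ ξ ∈ Distribution.dsupport (𝓕 (Lp.toTemperedDistribution f) : 𝓢'(E, ℂ)),
      ∀ η ∈ Distribution.dsupport (𝓕 (Lp.toTemperedDistribution g) : 𝓢'(E, ℂ)), ξ + η ∈ K) :
    Distribution.dsupport (𝓕 (Lp.toTemperedDistribution P) : 𝓢'(E, ℂ)) ⊆ K := by
  intro x hx
  by_contra hxK
  obtain ⟨r, hr, hrK⟩ := Metric.isOpen_iff.1 hK.isOpen_compl x hxK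
  refine (Distribution.notMem_dsupport_iff x).2 ⟨Metric.ball x (r / 3), fun φ hφ => ?_,
    Metric.isOpen_ball, Metric.mem_ball_self (by positivity)⟩ hx
  have hzero : ∀ j l, Lp.toTemperedDistribution
      (lpMul (multiplierLp (s j) f) (multiplierTop (s l) g)) (𝓕 φ) = 0 := fun j l =>
    toTemperedDistribution_lpMul_fourier_eq_zero f g (hsc j) (hsc l) (by positivity)
      (fun ξ hξ η hη => by
        by_contra! h
        exact hrK (by rw [Metric.mem_ball]; linarith) (hsub ξ hξ η hη)) hφ
  have h1 : ∀ j, Lp.toTemperedDistribution (Q j) (𝓕 φ) = 0 := fun j =>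
    (hasSum_toTemperedDistribution (hQ j) (𝓕 φ)).unique (by simpa only [hzero] using hasSum_zero)
  exact (hasSum_toTemperedDistribution hP (𝓕 φ)).unique (by simpa only [h1] using hasSum_zero)

end Product

section BoxProduct

variable {n : ℕ} {ρ : EuclideanSpace ℝ (Fin n) → ℝ}

theorem exists_enorm_box_product_le (hρ : IsWindow ρ) (p : ℝ≥0∞) [Fact (1 ≤ p)] :
    ∃ C : ℝ≥0∞, C ≠ ⊤ ∧ ∀ (f g P : Lp ℂ p (volume : Measure (EuclideanSpace ℝ (Fin n))))
      (Q : (Fin n → ℤ) → Lp ℂ p (volume : Measure (EuclideanSpace ℝ (Fin n)))),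
      (∀ j, HasSum (fun l => lpMul (multiplierLp (boxSymbol hρ j) f)
        (multiplierTop (boxSymbol hρ l) g)) (Q j)) → HasSum Q P →
      ∀ k, ‖multiplierLp (boxSymbol hρ k) P‖ₑ ≤ C * ∑' j, ∑' l,
        (latticeBox n 3 : Set (Fin n → ℤ)).indicator 1 (k - j - l) *
          (‖multiplierLp (boxSymbol hρ j) f‖ₑ * ‖multiplierLp (boxSymbol hρ l) g‖ₑ) := by
  obtain ⟨C₁, hC₁, h₁⟩ := exists_enorm_boxLp_le hρ p
  obtain ⟨C₂, hC₂, h₂⟩ := exists_enorm_boxTop_le hρ p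
  refine ⟨C₁ * C₂, ENNReal.mul_ne_top hC₁ hC₂, fun f g P Q hQ hP k => ?_⟩
  let B : Lp ℂ p (volume : Measure (EuclideanSpace ℝ (Fin n))) →L[ℂ] Lp ℂ p volume :=
    ⟨multiplierLp (boxSymbol hρ k), continuous_multiplierLp _⟩
  have hPk := (hP.mapL B).tsum_eq
  have hQk := fun j => ((hQ j).mapL B).tsum_eq
  change ‖B P‖ₑ ≤ _
  rw [← hPk]
  refine enorm_tsum_le_tsum_enorm.trans ?_
  rw [← ENNReal.tsum_mul_left]
  refine ENNReal.tsum_le_tsum fun j => ?_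
  rw [← hQk j]
  refine enorm_tsum_le_tsum_enorm.trans ?_
  rw [← ENNReal.tsum_mul_left]
  refine ENNReal.tsum_le_tsum fun l => ?_
  by_cases hkl : k - j - l ∈ latticeBox n 3
  · rw [indicator_of_mem (by exact_mod_cast hkl), Pi.one_apply, one_mul]
    calc _ ≤ C₁ * ‖lpMul (multiplierLp (boxSymbol hρ j) f) (multiplierTop (boxSymbol hρ l) g)‖ₑ :=
          h₁ k _
      _ ≤ C₁ * (‖multiplierLp (boxSymbol hρ j) f‖ₑ * (C₂ * ‖multiplierLp (boxSymbol hρ l) g‖ₑ)) := by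
          gcongr
          exact (enorm_lpMul_le _ _).trans (by gcongr; exact h₂ l g)
      _ = _ := by ring
  -- Each of the three symbols reaches distance 1 from its lattice point in every coordinate;
  -- together this gives the box of size 3.
  · have hz : B (lpMul (multiplierLp (boxSymbol hρ j) f) (multiplierTop (boxSymbol hρ l) g)) = 0 := by
      refine multiplierLp_lpMul_eq_zero _ _ _ f g fun ξ η hξ hη => ?_
      by_contra hk
      refine hkl (mem_latticeBox.2 fun i => ?_)
      have e1 := abs_sub_le_of_boxSymbol_ne_zero hρ hξ i
      have e2 := abs_sub_le_of_boxSymbol_ne_zero hρ hη i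
      have e3 := abs_sub_le_of_boxSymbol_ne_zero hρ hk i
      rw [PiLp.add_apply, mul_add] at e3
      simp only [Pi.sub_apply, Int.cast_sub, Nat.cast_ofNat]
      rw [abs_le] at e1 e2 e3 ⊢
      constructor <;> linarith [e1.1, e1.2, e2.1, e2.2, e3.1, e3.2]
    rw [hz]
    simp

end BoxProduct

end

/-! ## The modulation norm -/

section Norm

variable {n : ℕ} {ρ : EuclideanSpace ℝ (Fin n) → ℝ} {w : ℝ → ℝ} {p q q' : ℝ≥0∞}
  [hp : Fact (1 ≤ p)]

theorem distLpNorm_toTemperedDistribution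
    (f : Lp ℂ p (volume : Measure (EuclideanSpace ℝ (Fin n)))) :
    distLpNorm p (Lp.toTemperedDistribution f) = ‖f‖ₑ := by
  unfold distLpNorm
  refine le_antisymm ((iInf_le _ f).trans (iInf_le _ rfl)) (le_iInf₂ fun h hh => ?_)
  rw [toTemperedDistribution_injective hh]

theorem box_toTemperedDistribution (hρ : IsWindow ρ) (k : Fin n → ℤ)
    (f : Lp ℂ p (volume : Measure (EuclideanSpace ℝ (Fin n)))) :
    box ρ k (Lp.toTemperedDistribution f) =
      Lp.toTemperedDistribution (multiplierLp (boxSymbol hρ k) f) :=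
  (toTemperedDistribution_multiplierLp (boxSymbol hρ k) f).symm

theorem modulationNorm_coe (hρ : IsWindow ρ)
    (f : Lp ℂ p (volume : Measure (EuclideanSpace ℝ (Fin n)))) :
    modulationNorm ρ w p q f = lqNorm q fun k : Fin n → ℤ =>
      ENNReal.ofReal (Real.exp (w ‖latticePoint k‖)) * ‖multiplierLp (boxSymbol hρ k) f‖ₑ := by
  unfold modulationNorm
  rw [dif_pos f.2]
  simp only [Subtype.coe_eta, box_toTemperedDistribution hρ, distLpNorm_toTemperedDistribution]

theorem modulationNorm_add_le (hρ : IsWindow ρ) (hq : 1 ≤ q)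
    (f g : Lp ℂ p (volume : Measure (EuclideanSpace ℝ (Fin n)))) :
    modulationNorm ρ w p q ((f + g : Lp ℂ p volume) : EuclideanSpace ℝ (Fin n) →ₘ[volume] ℂ) ≤
      modulationNorm ρ w p q f + modulationNorm ρ w p q g := by
  simp only [modulationNorm_coe hρ]
  refine (lqNorm_mono fun k => ?_).trans (lqNorm_add_le hq _ _)
  rw [map_add, ← mul_add]
  gcongr
  exact enorm_add_le _ _

theorem modulationNorm_smul (hρ : IsWindow ρ) (hq : 1 ≤ q) (c : ℂ)
    (f : Lp ℂ p (volume : Measure (EuclideanSpace ℝ (Fin n)))) :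
    modulationNorm ρ w p q ((c • f : Lp ℂ p volume) : EuclideanSpace ℝ (Fin n) →ₘ[volume] ℂ) =
      ‖c‖ₑ * modulationNorm ρ w p q f := by
  simp only [modulationNorm_coe hρ]
  rw [← lqNorm_const_mul hq]
  congr 1
  ext k
  rw [map_smul, enorm_smul]
  ring

theorem modulationNorm_zero (hρ : IsWindow ρ) (hq : 1 ≤ q) :
    modulationNorm ρ w p q (0 : EuclideanSpace ℝ (Fin n) →ₘ[volume] ℂ) = 0 := by
  have := modulationNorm_smul (w := w) (p := p) hρ hq 0 0
  simpa using this

theorem exists_submodule_modulationSpace (hρ : IsWindow ρ) (hq : 1 ≤ q) :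
    ∃ V : Submodule ℂ (EuclideanSpace ℝ (Fin n) →ₘ[volume] ℂ),
      (V : Set _) = modulationSpace ρ w p q := by
  refine ⟨⟨⟨⟨modulationSpace ρ w p q, ?_⟩, ?_⟩, ?_⟩, rfl⟩
  · rintro f g ⟨hf, hf'⟩ ⟨hg, hg'⟩
    exact ⟨add_mem hf hg, (modulationNorm_add_le hρ hq ⟨f, hf⟩ ⟨g, hg⟩).trans_lt
      (ENNReal.add_lt_top.2 ⟨hf', hg'⟩)⟩
  · exact ⟨zero_mem _, by rw [modulationNorm_zero hρ hq]; exact ENNReal.zero_lt_top⟩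
  · rintro c f ⟨hf, hf'⟩
    exact ⟨Lp.const_smul_mem_Lp c ⟨f, hf⟩, (modulationNorm_smul hρ hq c ⟨f, hf⟩).trans_lt
      (ENNReal.mul_lt_top enorm_lt_top hf')⟩

/-! ## The product estimate -/

theorem one_le_conjugate (hqq : 1 / q + 1 / q' = 1) : 1 ≤ q' := by
  have h : 1 / q' ≤ 1 := le_add_self.trans_eq hqq
  rwa [one_div, ENNReal.inv_le_one] at h

theorem lqNorm_exp_neg_ne_top (hw : IsAdmissibleWeight w) (n : ℕ) (hq' : 1 ≤ q') {r : ℝ}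
    (hr : 0 < r) :
    lqNorm q' (fun k : Fin n → ℤ => ENNReal.ofReal (Real.exp (-(r * w ‖latticePoint k‖)))) ≠ ⊤ := by
  refine lqNorm_ne_top_of_tsum_ne_top hq' (fun k => ?_) (hw.tsum_exp_neg_ne_top n hr)
  rw [ENNReal.ofReal_le_one, Real.exp_le_one_iff, neg_nonpos]
  exact mul_nonneg hr.le (hw.pos (norm_nonneg _)).le

/-- Hölder against e^{-w} ∈ ℓ^{q'}: for every q the weight forces absolute convergence of the
frequency decomposition. -/
theorem summable_norm_box (hρ : IsWindow ρ) (hw : IsAdmissibleWeight w)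
    (hqq : 1 / q + 1 / q' = 1) (f : Lp ℂ p (volume : Measure (EuclideanSpace ℝ (Fin n))))
    (hf : modulationNorm ρ w p q f < ⊤) :
    Summable fun j => ‖multiplierLp (boxSymbol hρ j) f‖ := by
  rw [← tsum_enorm_ne_top_iff_summable_norm]
  rw [modulationNorm_coe hρ] at hf
  have h1 := tsum_mul_le_lqNorm_mul_lqNorm hqq (fun k : Fin n → ℤ =>
      ENNReal.ofReal (Real.exp (w ‖latticePoint k‖)) * ‖multiplierLp (boxSymbol hρ k) f‖ₑ)
    (fun k : Fin n → ℤ => ENNReal.ofReal (Real.exp (-(1 * w ‖latticePoint k‖))))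
  refine ne_top_of_le_ne_top (ENNReal.mul_ne_top hf.ne
    (lqNorm_exp_neg_ne_top hw n (one_le_conjugate hqq) one_pos)) (le_trans (le_of_eq ?_) h1)
  refine tsum_congr fun k => ?_
  rw [mul_right_comm, ← ENNReal.ofReal_mul (by positivity), ← Real.exp_add]
  simp

theorem summable_norm_boxTop (hρ : IsWindow ρ)
    (f : Lp ℂ p (volume : Measure (EuclideanSpace ℝ (Fin n))))
    (hf : Summable fun j => ‖multiplierLp (boxSymbol hρ j) f‖) :
    Summable fun j => ‖multiplierTop (boxSymbol hρ j) f‖ := by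
  obtain ⟨C, hC, h⟩ := exists_enorm_boxTop_le hρ p
  rw [← tsum_enorm_ne_top_iff_summable_norm] at hf ⊢
  refine ne_top_of_le_ne_top (ENNReal.mul_ne_top hC hf) ?_
  rw [← ENNReal.tsum_mul_left]
  exact ENNReal.tsum_le_tsum fun j => h j f

theorem norm_latticePoint_le_of_sub_mem {k j l : Fin n → ℤ} (h : k - j - l ∈ latticeBox n 3) :
    ‖latticePoint k‖ ≤ ‖latticePoint j‖ + ‖latticePoint l‖ + (3 * n + 1) := by
  have h1 : latticePoint k = latticePoint j + latticePoint l + latticePoint (k - j - l) := by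
    rw [latticePoint_sub, latticePoint_sub]; abel
  have h2 : ‖latticePoint (k - j - l)‖ ≤ 3 * n + 1 := by
    rw [mem_latticeBox] at h
    refine (EuclideanSpace.norm_eq _).trans_le ((Real.sqrt_le_left (by positivity)).2 ?_)
    calc ∑ i, ‖latticePoint (k - j - l) i‖ ^ 2 ≤ ∑ _i : Fin n, (3 : ℝ) ^ 2 :=
          Finset.sum_le_sum fun i _ =>
            pow_le_pow_left₀ (norm_nonneg _) (by simpa using h i) 2
      _ = 9 * n := by simp; ring
      _ ≤ (3 * n + 1) ^ 2 := by
          have : (n : ℝ) ≤ ((n ^ 2 : ℕ) : ℝ) := by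
            exact_mod_cast Nat.le_self_pow (by norm_num) n
          push_cast at this
          nlinarith
  rw [h1]
  exact (norm_add_le _ _).trans (add_le_add (norm_add_le _ _) h2)

/-- The set Z of active frequencies is left free, with C independent of it: all of ℤⁿ yields the
algebra property, {|k| ≥ R-2} the decay in R. -/
theorem exists_modulationNorm_mul_le (hρ : IsWindow ρ) (hw : IsAdmissibleWeight w) {s : ℝ}
    (hsub : ∀ a : ℝ, 0 < a → ∃ C : ℝ, 0 ≤ C ∧ ∀ x y z : ℝ, 0 ≤ x → 0 ≤ y → 0 ≤ z →
      z ≤ x + y + a → w z ≤ w x + w y - s * min (w x) (w y) + C)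
    (hq : 1 ≤ q) (hqq : 1 / q + 1 / q' = 1) (p : ℝ≥0∞) [Fact (1 ≤ p)] :
    ∃ C : ℝ≥0∞, C ≠ ⊤ ∧
      ∀ f g : Lp ℂ p (volume : Measure (EuclideanSpace ℝ (Fin n))),
        modulationNorm ρ w p q f < ⊤ → modulationNorm ρ w p q g < ⊤ →
        ∃ P : Lp ℂ p (volume : Measure (EuclideanSpace ℝ (Fin n))),
          (P : EuclideanSpace ℝ (Fin n) →ₘ[volume] ℂ) = f * g ∧
          (∀ K : Set (EuclideanSpace ℝ (Fin n)), IsClosed K →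
            (∀ ξ ∈ Distribution.dsupport
                (𝓕 (Lp.toTemperedDistribution f) : 𝓢'(EuclideanSpace ℝ (Fin n), ℂ)),
              ∀ η ∈ Distribution.dsupport
                (𝓕 (Lp.toTemperedDistribution g) : 𝓢'(EuclideanSpace ℝ (Fin n), ℂ)), ξ + η ∈ K) →
            Distribution.dsupport
              (𝓕 (Lp.toTemperedDistribution P) : 𝓢'(EuclideanSpace ℝ (Fin n), ℂ)) ⊆ K) ∧
          ∀ Z : Set (Fin n → ℤ), (∀ j ∉ Z, multiplierLp (boxSymbol hρ j) f = 0) →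
            (∀ j ∉ Z, multiplierLp (boxSymbol hρ j) g = 0) →
            modulationNorm ρ w p q P ≤ C * lqNorm q' (Z.indicator fun k =>
              ENNReal.ofReal (Real.exp (-(s * w ‖latticePoint k‖)))) *
                modulationNorm ρ w p q f * modulationNorm ρ w p q g := by
  obtain ⟨C, hC, hprod⟩ := exists_enorm_box_product_le hρ p
  obtain ⟨K, -, hK⟩ := hsub (3 * n + 1) (by positivity)
  refine ⟨C * ENNReal.ofReal (Real.exp K) * (2 * (latticeBox n 3).card),
    ENNReal.mul_ne_top (ENNReal.mul_ne_top hC ENNReal.ofReal_ne_top)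
      (ENNReal.mul_ne_top (by norm_num) (ENNReal.natCast_ne_top _)), fun f g hf hg => ?_⟩
  have hfs := summable_norm_box hρ hw hqq f hf
  have hgs := summable_norm_boxTop hρ g (summable_norm_box hρ hw hqq g hg)
  obtain ⟨P, hP, Q, hQ, hQP⟩ := (isFrequencyPartition_boxSymbol hρ).exists_product f g hfs hgs
  refine ⟨P, hP, fun D hD hsubD =>
    dsupport_product_subset (hasCompactSupport_boxSymbol hρ) hQ hQP hD hsubD, fun Z hfZ hgZ => ?_⟩
  rw [modulationNorm_coe hρ P, modulationNorm_coe hρ f, modulationNorm_coe hρ g]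
  refine lqNorm_weighted_convolution_le hq hqq (latticeBox n 3)
    (C * ENNReal.ofReal (Real.exp K)) _ _ _ _ fun k => ?_
  refine (mul_le_mul_right (hprod f g P Q hQ hQP k) _).trans ?_
  rw [mul_left_comm, mul_assoc C]
  refine mul_le_mul_right ?_ C
  rw [← ENNReal.tsum_mul_left, ← ENNReal.tsum_mul_left]
  refine ENNReal.tsum_le_tsum fun j => ?_
  rw [← ENNReal.tsum_mul_left, ← ENNReal.tsum_mul_left]
  refine ENNReal.tsum_le_tsum fun l => ?_
  by_cases hkl : k - j - l ∈ latticeBox n 3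
  swap
  · rw [indicator_of_notMem (by exact_mod_cast hkl)]
    simp
  rw [indicator_of_mem (by exact_mod_cast hkl)]
  simp only [Pi.one_apply, one_mul]
  by_cases hj : j ∈ Z
  swap
  · simp [hfZ j hj]
  by_cases hl : l ∈ Z
  swap
  · simp [hgZ l hl]
  rw [indicator_of_mem hj, indicator_of_mem hl]
  have hwk := hK _ _ _ (norm_nonneg (latticePoint j)) (norm_nonneg (latticePoint l))
    (norm_nonneg (latticePoint k)) (norm_latticePoint_le_of_sub_mem hkl)
  have hE : ENNReal.ofReal (Real.exp (w ‖latticePoint k‖)) ≤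
      ENNReal.ofReal (Real.exp K) * (ENNReal.ofReal (Real.exp (w ‖latticePoint j‖)) *
        ENNReal.ofReal (Real.exp (w ‖latticePoint l‖)) *
        (ENNReal.ofReal (Real.exp (-(s * w ‖latticePoint j‖))) +
          ENNReal.ofReal (Real.exp (-(s * w ‖latticePoint l‖))))) := by
    rw [← ENNReal.ofReal_add (by positivity) (by positivity),
      ← ENNReal.ofReal_mul (by positivity), ← ENNReal.ofReal_mul (by positivity),
      ← ENNReal.ofReal_mul (by positivity)]
    refine ENNReal.ofReal_le_ofReal ((Real.exp_le_exp.2 hwk).trans ?_)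
    have e1 : Real.exp (-(s * min (w ‖latticePoint j‖) (w ‖latticePoint l‖))) ≤
        Real.exp (-(s * w ‖latticePoint j‖)) + Real.exp (-(s * w ‖latticePoint l‖)) := by
      rcases min_choice (w ‖latticePoint j‖) (w ‖latticePoint l‖) with h | h <;> rw [h]
      · linarith [Real.exp_pos (-(s * w ‖latticePoint l‖))]
      · linarith [Real.exp_pos (-(s * w ‖latticePoint j‖))]
    rw [sub_eq_add_neg, Real.exp_add, Real.exp_add, Real.exp_add, mul_comm]
    gcongr
  refine (mul_le_mul_left hE _).trans_eq ?_
  ring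

theorem isPointwiseAlgebra_modulationSpace (hρ : IsWindow ρ) (hw : IsAdmissibleWeight w) {s : ℝ}
    (hs : 0 < s)
    (hsub : ∀ a : ℝ, 0 < a → ∃ C : ℝ, 0 ≤ C ∧ ∀ x y z : ℝ, 0 ≤ x → 0 ≤ y → 0 ≤ z →
      z ≤ x + y + a → w z ≤ w x + w y - s * min (w x) (w y) + C)
    (hq : 1 ≤ q) (hqq : 1 / q + 1 / q' = 1) (p : ℝ≥0∞) [Fact (1 ≤ p)] :
    IsPointwiseAlgebra (modulationSpace ρ w p q) := by
  refine ⟨exists_submodule_modulationSpace hρ hq, ?_⟩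
  rintro f ⟨hf, hf'⟩ g ⟨hg, hg'⟩
  obtain ⟨C, hC, h⟩ := exists_modulationNorm_mul_le hρ hw hsub hq hqq p
  obtain ⟨P, hP, -, hZ⟩ := h ⟨f, hf⟩ ⟨g, hg⟩ hf' hg'
  have hb := hZ univ (fun j hj => absurd (mem_univ j) hj) (fun j hj => absurd (mem_univ j) hj)
  rw [indicator_univ] at hb
  change (P : EuclideanSpace ℝ (Fin n) →ₘ[volume] ℂ) = f * g at hP
  rw [← hP]
  refine ⟨P.2, hb.trans_lt ?_⟩
  exact ENNReal.mul_lt_top (ENNReal.mul_lt_top (ENNReal.mul_lt_top hC.lt_top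
    (lqNorm_exp_neg_ne_top hw n (one_le_conjugate hqq) hs).lt_top) hf') hg'

end Norm

/-! ## Sets of frequencies in an orthant -/

section Orthant

variable {n : ℕ}

theorem sign_eq_neg_one_pow_iff (e : Fin 2) (x : ℝ) :
    Real.sign x = (-1) ^ (e : ℕ) ↔ 0 < (-1) ^ (e : ℕ) * x := by
  rcases lt_trichotomy x 0 with h | h | h <;> fin_cases e <;>
    simp [Real.sign, h, h.not_gt] <;> norm_num

theorem mem_orthantOutsideCube {ε : Fin n → Fin 2} {R : ℝ} {ξ : EuclideanSpace ℝ (Fin n)} :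
    ξ ∈ orthantOutsideCube ε R ↔
      (∀ j, 0 < (-1) ^ (ε j : ℕ) * ξ j) ∧ ∃ j, R < |ξ j| := by
  simp [orthantOutsideCube, cube, sign_eq_neg_one_pow_iff]

theorem abs_le_abs_add {σ x y : ℝ} (hx : 0 < σ * x) (hy : 0 < σ * y) : |x| ≤ |x + y| := by
  rcases lt_trichotomy σ 0 with h | h | h
  · have hx' : x < 0 := by nlinarith
    have hy' : y < 0 := by nlinarith
    rw [abs_of_neg hx', abs_of_neg (by linarith)]
    linarith
  · simp [h] at hx
  · have hx' : 0 < x := by nlinarith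
    have hy' : 0 < y := by nlinarith
    rw [abs_of_pos hx', abs_of_pos (by linarith)]
    linarith

theorem add_mem_orthantOutsideCube {ε : Fin n → Fin 2} {R : ℝ} {ξ η : EuclideanSpace ℝ (Fin n)}
    (hξ : ξ ∈ orthantOutsideCube ε R) (hη : η ∈ orthantOutsideCube ε R) :
    ξ + η ∈ orthantOutsideCube ε R := by
  rw [mem_orthantOutsideCube] at *
  obtain ⟨h1, j, hj⟩ := hξ
  refine ⟨fun i => ?_, j, hj.trans_le (abs_le_abs_add (h1 j) (hη.1 j))⟩
  rw [PiLp.add_apply, mul_add]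
  exact add_pos (h1 i) (hη.1 i)

open scoped Pointwise in
-- A sum of closed sets need not be closed. In an orthant |ξ_j| ≤ |ξ_j + η_j|, so a convergent
-- sequence of sums has bounded first summands and compactness applies. Closedness matters because
-- P_R(ε) is open: the closure of a subset could reach its boundary.
theorem isClosed_add_of_orthant (σ : Fin n → ℝ) {A B : Set (EuclideanSpace ℝ (Fin n))}
    (hA : IsClosed A) (hB : IsClosed B) (hA' : ∀ ξ ∈ A, ∀ j, 0 < σ j * ξ j)
    (hB' : ∀ ξ ∈ B, ∀ j, 0 < σ j * ξ j) : IsClosed (A + B) := by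
  rw [← isSeqClosed_iff_isClosed]
  intro u x hu hx
  choose a ha b hb hab using hu
  obtain ⟨M, hM⟩ := (Metric.isBounded_range_of_tendsto u hx).exists_norm_le
  have hbd : Bornology.IsBounded (range a) := by
    refine isBounded_iff_forall_norm_le.2 ⟨M, ?_⟩
    rintro _ ⟨k, rfl⟩
    refine le_trans ?_ (hM _ (mem_range_self k))
    rw [EuclideanSpace.norm_eq, EuclideanSpace.norm_eq]
    refine Real.sqrt_le_sqrt (Finset.sum_le_sum fun j _ => ?_)
    refine pow_le_pow_left₀ (norm_nonneg _) ?_ 2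
    rw [← hab k]
    exact abs_le_abs_add (hA' _ (ha k) j) (hB' _ (hb k) j)
  obtain ⟨y, -, φ, hφ, hy⟩ := tendsto_subseq_of_bounded hbd fun k => mem_range_self k
  have hya : y ∈ A := hA.mem_of_tendsto hy (Eventually.of_forall fun k => ha _)
  have hb' : Tendsto (b ∘ φ) atTop (𝓝 (x - y)) := by
    refine ((hx.comp hφ.tendsto_atTop).sub hy).congr fun k => ?_
    simp [← hab]
  exact ⟨y, hya, x - y, hB.mem_of_tendsto hb' (Eventually.of_forall fun k => hb _), by simp⟩

end Orthant

/-! ## Supports of linear combinations -/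

section Support

variable {E : Type*} [NormedAddCommGroup E] [InnerProductSpace ℝ E]

theorem dsupport_add_subset (T S : 𝓢'(E, ℂ)) :
    Distribution.dsupport (T + S) ⊆ Distribution.dsupport T ∪ Distribution.dsupport S := by
  intro x hx
  by_contra h
  rw [mem_union, not_or] at h
  obtain ⟨U, hU, hUo, hxU⟩ := (Distribution.notMem_dsupport_iff x).1 h.1
  obtain ⟨V, hV, hVo, hxV⟩ := (Distribution.notMem_dsupport_iff x).1 h.2
  refine (Distribution.notMem_dsupport_iff x).2 ⟨U ∩ V, fun φ hφ => ?_, hUo.inter hVo, hxU, hxV⟩ hx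
  have h1 := hU φ (hφ.trans inter_subset_left)
  have h2 := hV φ (hφ.trans inter_subset_right)
  change T φ + S φ = 0
  rw [h1, h2, add_zero]

theorem dsupport_smul_subset (c : ℂ) (T : 𝓢'(E, ℂ)) :
    Distribution.dsupport (c • T) ⊆ Distribution.dsupport T := by
  intro x hx
  by_contra h
  obtain ⟨U, hU, hUo, hxU⟩ := (Distribution.notMem_dsupport_iff x).1 h
  refine (Distribution.notMem_dsupport_iff x).2 ⟨U, fun φ hφ => ?_, hUo, hxU⟩ hx
  change c • T φ = 0
  rw [hU φ hφ, smul_zero]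

theorem dsupport_zero : Distribution.dsupport (0 : 𝓢'(E, ℂ)) = ∅ :=
  eq_empty_of_forall_notMem fun x => (Distribution.notMem_dsupport_iff x).2
    ⟨univ, fun _ _ => rfl, isOpen_univ, mem_univ x⟩

end Support

/-! ## Functions with Fourier support in an orthant -/

section OrthantSpace

variable {n : ℕ} {ρ : EuclideanSpace ℝ (Fin n) → ℝ} {w : ℝ → ℝ} {p q q' : ℝ≥0∞}
  [hp : Fact (1 ≤ p)] {ε : Fin n → Fin 2} {R : ℝ}

theorem toTemperedDistribution_add (f g : Lp ℂ p (volume : Measure (EuclideanSpace ℝ (Fin n)))) :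
    Lp.toTemperedDistribution (f + g) =
      Lp.toTemperedDistribution f + Lp.toTemperedDistribution g :=
  map_add (Lp.toTemperedDistributionCLM ℂ (volume : Measure (EuclideanSpace ℝ (Fin n))) p) f g

theorem toTemperedDistribution_smul (c : ℂ)
    (f : Lp ℂ p (volume : Measure (EuclideanSpace ℝ (Fin n)))) :
    Lp.toTemperedDistribution (c • f) = c • Lp.toTemperedDistribution f :=
  map_smul (Lp.toTemperedDistributionCLM ℂ (volume : Measure (EuclideanSpace ℝ (Fin n))) p) c f

theorem toTemperedDistribution_zero :
    Lp.toTemperedDistribution (0 : Lp ℂ p (volume : Measure (EuclideanSpace ℝ (Fin n)))) = 0 :=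
  map_zero (Lp.toTemperedDistributionCLM ℂ (volume : Measure (EuclideanSpace ℝ (Fin n))) p)

theorem fourierSupport_subset_iff {u : 𝓢'(EuclideanSpace ℝ (Fin n), ℂ)}
    {O : Set (EuclideanSpace ℝ (Fin n))} :
    fourierSupport u ⊆ O ↔
      Distribution.dsupport (𝓕 u : 𝓢'(EuclideanSpace ℝ (Fin n), ℂ)) ⊆
        (fun η => (2 * Real.pi) • η) ⁻¹' O :=
  image_subset_iff

theorem mem_modulationSpaceOrthant_coe
    {f : Lp ℂ p (volume : Measure (EuclideanSpace ℝ (Fin n)))} :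
    (f : EuclideanSpace ℝ (Fin n) →ₘ[volume] ℂ) ∈ modulationSpaceOrthant ρ w p q ε R ↔
      modulationNorm ρ w p q f < ⊤ ∧
        Distribution.dsupport
          (𝓕 (Lp.toTemperedDistribution f) : 𝓢'(EuclideanSpace ℝ (Fin n), ℂ)) ⊆
            (fun η => (2 * Real.pi) • η) ⁻¹' orthantOutsideCube ε R := by
  rw [← fourierSupport_subset_iff]
  exact ⟨fun ⟨h1, _, h2⟩ => ⟨h1.2, h2⟩, fun ⟨h1, h2⟩ => ⟨⟨f.2, h1⟩, f.2, h2⟩⟩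

theorem exists_coe_eq_of_mem_modulationSpaceOrthant {f : EuclideanSpace ℝ (Fin n) →ₘ[volume] ℂ}
    (hf : f ∈ modulationSpaceOrthant ρ w p q ε R) :
    ∃ f' : Lp ℂ p (volume : Measure (EuclideanSpace ℝ (Fin n))),
      (f' : EuclideanSpace ℝ (Fin n) →ₘ[volume] ℂ) = f :=
  ⟨⟨f, hf.1.1⟩, rfl⟩

theorem exists_submodule_modulationSpaceOrthant (hρ : IsWindow ρ) (hq : 1 ≤ q) :
    ∃ V : Submodule ℂ (EuclideanSpace ℝ (Fin n) →ₘ[volume] ℂ),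
      (V : Set _) = modulationSpaceOrthant ρ w p q ε R := by
  refine ⟨⟨⟨⟨modulationSpaceOrthant ρ w p q ε R, ?_⟩, ?_⟩, ?_⟩, rfl⟩
  · intro f g hf hg
    obtain ⟨f, rfl⟩ := exists_coe_eq_of_mem_modulationSpaceOrthant hf
    obtain ⟨g, rfl⟩ := exists_coe_eq_of_mem_modulationSpaceOrthant hg
    change ((f + g : Lp ℂ p volume) : EuclideanSpace ℝ (Fin n) →ₘ[volume] ℂ) ∈ _
    rw [mem_modulationSpaceOrthant_coe] at *
    refine ⟨(modulationNorm_add_le hρ hq f g).trans_lt (ENNReal.add_lt_top.2 ⟨hf.1, hg.1⟩), ?_⟩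
    rw [toTemperedDistribution_add, FourierTransform.fourier_add]
    exact (dsupport_add_subset _ _).trans (union_subset hf.2 hg.2)
  · change ((0 : Lp ℂ p (volume : Measure (EuclideanSpace ℝ (Fin n)))) :
      EuclideanSpace ℝ (Fin n) →ₘ[volume] ℂ) ∈ _
    rw [mem_modulationSpaceOrthant_coe, toTemperedDistribution_zero, FourierTransform.fourier_zero,
      dsupport_zero]
    refine ⟨?_, empty_subset _⟩
    exact (modulationNorm_zero hρ hq).trans_lt ENNReal.zero_lt_top
  · intro c f hf
    obtain ⟨f, rfl⟩ := exists_coe_eq_of_mem_modulationSpaceOrthant hf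
    change ((c • f : Lp ℂ p volume) : EuclideanSpace ℝ (Fin n) →ₘ[volume] ℂ) ∈ _
    rw [mem_modulationSpaceOrthant_coe] at *
    refine ⟨(modulationNorm_smul hρ hq c f).trans_lt (ENNReal.mul_lt_top enorm_lt_top hf.1), ?_⟩
    rw [toTemperedDistribution_smul, FourierTransform.fourier_smul]
    exact (dsupport_smul_subset _ _).trans hf.2

theorem isPointwiseAlgebra_modulationSpaceOrthant (hρ : IsWindow ρ) (hw : IsAdmissibleWeight w)
    {s : ℝ} (hs : 0 < s)
    (hsub : ∀ a : ℝ, 0 < a → ∃ C : ℝ, 0 ≤ C ∧ ∀ x y z : ℝ, 0 ≤ x → 0 ≤ y → 0 ≤ z →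
      z ≤ x + y + a → w z ≤ w x + w y - s * min (w x) (w y) + C)
    (hq : 1 ≤ q) (hqq : 1 / q + 1 / q' = 1) (p : ℝ≥0∞) [Fact (1 ≤ p)] (ε : Fin n → Fin 2)
    (R : ℝ) : IsPointwiseAlgebra (modulationSpaceOrthant ρ w p q ε R) := by
  refine ⟨exists_submodule_modulationSpaceOrthant hρ hq, fun f hf g hg => ?_⟩
  have hfg := (isPointwiseAlgebra_modulationSpace hρ hw hs hsub hq hqq p).2 f hf.1 g hg.1
  obtain ⟨f, rfl⟩ := exists_coe_eq_of_mem_modulationSpaceOrthant hf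
  obtain ⟨g, rfl⟩ := exists_coe_eq_of_mem_modulationSpaceOrthant hg
  obtain ⟨C, hC, h⟩ := exists_modulationNorm_mul_le hρ hw hsub hq hqq p
  rw [mem_modulationSpaceOrthant_coe] at hf hg
  obtain ⟨P, hP, hK, -⟩ := h f g hf.1 hg.1
  rw [← hP] at hfg ⊢
  rw [mem_modulationSpaceOrthant_coe]
  refine ⟨hfg.2, (hK _ (isClosed_add_of_orthant (fun j => (-1) ^ (ε j : ℕ))
    Distribution.isClosed_dsupport Distribution.isClosed_dsupport (fun ξ hξ j => ?_)
    fun ξ hξ j => ?_) fun ξ hξ η hη => add_mem_add hξ hη).trans ?_⟩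
  · have := (mem_orthantOutsideCube.1 (hf.2 hξ)).1 j
    rw [PiLp.smul_apply, smul_eq_mul, mul_left_comm] at this
    exact pos_of_mul_pos_right this (by positivity)
  · have := (mem_orthantOutsideCube.1 (hg.2 hξ)).1 j
    rw [PiLp.smul_apply, smul_eq_mul, mul_left_comm] at this
    exact pos_of_mul_pos_right this (by positivity)
  · rintro _ ⟨ξ, hξ, η, hη, rfl⟩
    change (2 * Real.pi) • (ξ + η) ∈ orthantOutsideCube ε R
    rw [smul_add]
    exact add_mem_orthantOutsideCube (hf.2 hξ) (hg.2 hη)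

/-- A frequency in P_R(ε) has some coordinate of modulus above R, and the j-th symbol reaches only
distance 1 from j; a nonzero piece would need ‖j‖ > R - 1. -/
theorem multiplierLp_box_eq_zero_of_orthant (hρ : IsWindow ρ)
    {f : Lp ℂ p (volume : Measure (EuclideanSpace ℝ (Fin n)))}
    (hf : Distribution.dsupport
      (𝓕 (Lp.toTemperedDistribution f) : 𝓢'(EuclideanSpace ℝ (Fin n), ℂ)) ⊆
        (fun η => (2 * Real.pi) • η) ⁻¹' orthantOutsideCube ε R)
    {j : Fin n → ℤ} (hj : ‖latticePoint j‖ < R - 2) : multiplierLp (boxSymbol hρ j) f = 0 := by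
  refine multiplierLp_box_eq_zero_of_disjoint hρ j f (disjoint_left.2 fun η h1 h2 => ?_)
  obtain ⟨-, i, hi⟩ := mem_orthantOutsideCube.1 (hf h2)
  rw [PiLp.smul_apply, smul_eq_mul] at hi
  have h3 := tsupport_boxSymbol_subset hρ j h1 i
  have h4 := abs_le_norm_latticePoint j i
  have h5 := abs_sub_abs_le_abs_sub (2 * Real.pi * η i) (j i)
  linarith

/-- Write e^{-sw} as the square of e^{-(s/2)w}. On |k| ≥ R-2 monotonicity bounds one factor by
e^{-(s/2)w(R-2)}; the ℓ^{q'} norm of the other over the whole lattice enters the constant. -/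
theorem exists_modulationNorm_mul_le_of_orthant (hρ : IsWindow ρ) (hw : IsAdmissibleWeight w)
    {s : ℝ} (hsub : ∀ a : ℝ, 0 < a → ∃ C : ℝ, 0 ≤ C ∧ ∀ x y z : ℝ, 0 ≤ x → 0 ≤ y → 0 ≤ z →
      z ≤ x + y + a → w z ≤ w x + w y - s * min (w x) (w y) + C)
    (hs : 0 < s) (hq : 1 ≤ q) (hqq : 1 / q + 1 / q' = 1) (p : ℝ≥0∞) [Fact (1 ≤ p)] :
    ∃ C : ℝ≥0∞, C ≠ ⊤ ∧ ∀ (ε : Fin n → Fin 2) (R : ℝ), 2 ≤ R →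
      ∀ f ∈ modulationSpaceOrthant ρ w p q ε R, ∀ g ∈ modulationSpaceOrthant ρ w p q ε R,
        modulationNorm ρ w p q (f * g) ≤
          C * ENNReal.ofReal (Real.exp (-(s / 2 * w (R - 2)))) *
            modulationNorm ρ w p q f * modulationNorm ρ w p q g := by
  obtain ⟨C, hC, h⟩ := exists_modulationNorm_mul_le hρ hw hsub hq hqq p
  have hq' := one_le_conjugate hqq
  refine ⟨C * lqNorm q' (fun k : Fin n → ℤ =>
      ENNReal.ofReal (Real.exp (-(s / 2 * w ‖latticePoint k‖)))),
    ENNReal.mul_ne_top hC (lqNorm_exp_neg_ne_top hw n hq' (half_pos hs)),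
    fun ε R hR f hf g hg => ?_⟩
  obtain ⟨f, rfl⟩ := exists_coe_eq_of_mem_modulationSpaceOrthant hf
  obtain ⟨g, rfl⟩ := exists_coe_eq_of_mem_modulationSpaceOrthant hg
  rw [mem_modulationSpaceOrthant_coe] at hf hg
  obtain ⟨P, hP, -, hZ⟩ := h f g hf.1 hg.1
  rw [← hP]
  refine (hZ {j | R - 2 ≤ ‖latticePoint j‖}
    (fun j hj => multiplierLp_box_eq_zero_of_orthant hρ hf.2 (not_le.1 hj))
    (fun j hj => multiplierLp_box_eq_zero_of_orthant hρ hg.2 (not_le.1 hj))).trans ?_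
  refine mul_le_mul_left (mul_le_mul_left ?_ _) _
  rw [mul_assoc, mul_comm (lqNorm _ _)]
  refine mul_le_mul_right ?_ C
  rw [← lqNorm_const_mul hq']
  refine lqNorm_mono fun k => ?_
  by_cases hk : k ∈ {j : Fin n → ℤ | R - 2 ≤ ‖latticePoint j‖}
  swap
  · rw [indicator_of_notMem hk]
    exact bot_le
  rw [indicator_of_mem hk]
  rw [← ENNReal.ofReal_mul (by positivity), ← Real.exp_add]
  refine ENNReal.ofReal_le_ofReal (Real.exp_le_exp.2 ?_)
  have := hw.mono (sub_nonneg.2 hR) hk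
  nlinarith

end OrthantSpace

/-! ## The incomplete Gamma function -/

section GammaTail

variable {a : ℝ} {q' : ℝ≥0∞}

theorem integrableOn_rpow_mul_exp_neg (ha : 0 < a) :
    IntegrableOn (fun y : ℝ => y ^ (a - 1) * Real.exp (-y)) (Ioi 0) := by
  simpa only [mul_comm] using Real.GammaIntegral_convergent ha

/-- Beyond 1 + q'b the power y^{a-1} is at least 1, so the integral is at least e^{-1-q'b}; after
the q'-th root the loss is at most e^{-1}. -/
theorem exp_neg_le_gammaTail (ha : 1 ≤ a) (hq' : 1 ≤ q') {b : ℝ} (hb : 0 ≤ b) :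
    Real.exp (-1) * Real.exp (-b) ≤ gammaTail a q' b := by
  have he : Real.exp (-1) ≤ 1 := Real.exp_le_one_iff.2 (by norm_num)
  unfold gammaTail
  split_ifs with h
  · exact mul_le_of_le_one_left (Real.exp_pos _).le he
  have hr : 1 ≤ q'.toReal := by
    simpa using ENNReal.toReal_mono h hq'
  set r := q'.toReal
  have hrb : 0 ≤ r * b := by positivity
  have h1 : Real.exp (-(1 + r * b)) ≤ ∫ y in Ioi (r * b), y ^ (a - 1) * Real.exp (-y) := by
    rw [← integral_exp_neg_Ioi]
    have hsub : Ioi (1 + r * b) ⊆ Ioi (r * b) := Ioi_subset_Ioi (by linarith)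
    have hint : IntegrableOn (fun y : ℝ => y ^ (a - 1) * Real.exp (-y)) (Ioi (r * b)) :=
      (integrableOn_rpow_mul_exp_neg (by linarith)).mono_set (Ioi_subset_Ioi hrb)
    refine le_trans ?_ (setIntegral_mono_set hint ?_ hsub.eventuallyLE)
    · refine setIntegral_mono_on (integrableOn_exp_neg_Ioi _) (hint.mono_set hsub)
        measurableSet_Ioi fun y hy => ?_
      have hy1 : 1 ≤ y := by linarith [mem_Ioi.1 hy]
      exact le_mul_of_one_le_left (Real.exp_pos _).le (Real.one_le_rpow hy1 (by linarith))
    · filter_upwards [ae_restrict_mem measurableSet_Ioi] with y hy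
      have : 0 < y := hrb.trans_lt hy
      simp only [Pi.zero_apply]
      positivity
  refine le_trans ?_ (Real.rpow_le_rpow (Real.exp_pos _).le h1 (by positivity))
  rw [← Real.exp_mul, ← Real.exp_add, Real.exp_le_exp]
  field_simp
  nlinarith

theorem tendsto_gammaTail (ha : 0 < a) (hq' : 1 ≤ q') :
    Tendsto (gammaTail a q') atTop (𝓝 0) := by
  unfold gammaTail
  split_ifs with h
  · exact Real.tendsto_exp_neg_atTop_nhds_zero
  have hr : 1 ≤ q'.toReal := by
    simpa using ENNReal.toReal_mono h hq'
  have h1 : Tendsto (fun c : ℝ => ∫ y in Ioi c, y ^ (a - 1) * Real.exp (-y)) atTop (𝓝 0) := by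
    have h2 := intervalIntegral_tendsto_integral_Ioi 0 (integrableOn_rpow_mul_exp_neg ha) tendsto_id
    have h3 := (tendsto_const_nhds (x := ∫ y in Ioi (0 : ℝ), y ^ (a - 1) * Real.exp (-y))).sub h2
    rw [sub_self] at h3
    refine h3.congr' ?_
    filter_upwards [eventually_ge_atTop 0] with c hc
    rw [sub_eq_iff_eq_add', id,
      ← intervalIntegral.integral_interval_add_Ioi
        (integrableOn_rpow_mul_exp_neg ha)
        ((integrableOn_rpow_mul_exp_neg ha).mono_set (Ioi_subset_Ioi hc))]
  have h4 := (h1.comp (tendsto_id.const_mul_atTop (show 0 < q'.toReal by linarith))).rpow_const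
    (p := 1 / q'.toReal) (Or.inr (by positivity))
  rwa [Real.zero_rpow (by positivity)] at h4

end GammaTail

/-! ## The product constant -/

theorem tendsto_gammaTail_rpow {a c β : ℝ} {q' : ℝ≥0∞} (ha : 0 < a) (hq' : 1 ≤ q') (hc : 0 < c)
    (hβ : 0 < β) (C : ℝ) :
    Tendsto (fun R : ℝ => C * gammaTail a q' (c * (R - 2) ^ β)) atTop (𝓝 0) := by
  have h : Tendsto (fun R : ℝ => c * (R - 2) ^ β) atTop atTop :=
    ((tendsto_rpow_atTop hβ).comp (tendsto_atTop_add_const_right _ (-2) tendsto_id)).const_mul_atTop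
      hc
  simpa using ((tendsto_gammaTail ha hq').comp h).const_mul C

theorem exists_modulationNorm_mul_le_gammaTail {n : ℕ} {ρ : EuclideanSpace ℝ (Fin n) → ℝ}
    {w : ℝ → ℝ} {p q q' : ℝ≥0∞} [Fact (1 ≤ p)] {s a b β K : ℝ} {C : ℝ≥0∞} (hC : C ≠ ⊤)
    (h : ∀ (ε : Fin n → Fin 2) (R : ℝ), 2 ≤ R →
      ∀ f ∈ modulationSpaceOrthant ρ w p q ε R, ∀ g ∈ modulationSpaceOrthant ρ w p q ε R,
        modulationNorm ρ w p q (f * g) ≤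
          C * ENNReal.ofReal (Real.exp (-(s * w (R - 2)))) *
            modulationNorm ρ w p q f * modulationNorm ρ w p q g)
    (ha : 1 ≤ a) (hq' : 1 ≤ q') (hb : 0 ≤ b)
    (hw : ∀ x, 0 ≤ x → b * x ^ β ≤ s * w x + K) :
    ∃ C' : ℝ, 0 < C' ∧ ∀ (ε : Fin n → Fin 2) (R : ℝ), 2 ≤ R →
      ∀ f ∈ modulationSpaceOrthant ρ w p q ε R, ∀ g ∈ modulationSpaceOrthant ρ w p q ε R,
        modulationNorm ρ w p q (f * g) ≤
          ENNReal.ofReal (C' * gammaTail a q' (b * (R - 2) ^ β)) *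
            modulationNorm ρ w p q f * modulationNorm ρ w p q g := by
  refine ⟨(C.toReal + 1) * Real.exp (K + 1), by positivity, fun ε R hR f hf g hg =>
    (h ε R hR f hf g hg).trans ?_⟩
  gcongr
  have hR' : 0 ≤ R - 2 := sub_nonneg.2 hR
  have h1 := exp_neg_le_gammaTail ha hq' (b := b * (R - 2) ^ β) (by positivity)
  calc C * ENNReal.ofReal (Real.exp (-(s * w (R - 2))))
      = ENNReal.ofReal (C.toReal * Real.exp (-(s * w (R - 2)))) := by
        rw [ENNReal.ofReal_mul ENNReal.toReal_nonneg, ENNReal.ofReal_toReal hC]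
    _ ≤ _ := by
        refine ENNReal.ofReal_le_ofReal ?_
        rw [mul_assoc]
        gcongr
        · linarith
        refine le_trans ?_ (mul_le_mul_of_nonneg_left h1 (Real.exp_pos _).le)
        rw [← Real.exp_add, ← Real.exp_add, Real.exp_le_exp]
        linarith [hw _ hR']

end UltraModulation

/-! ### Choice of s and conclusion. -/

theorem mainTheorem7 (w : ℝ → ℝ) (hw : UltraModulation.IsAdmissibleWeightOne w)
    (α : ℝ) (wt : ℝ → ℝ) (hwt : UltraModulation.IsSlowlyVarying wt)
    (hrep : ∀ x : ℝ, 0 < x → w x = x ^ α * wt x) :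
    ∃ s : ℝ, 0 < s ∧
      (∃ x₁ : ℝ, 0 < x₁ ∧ ∀ x y : ℝ, 2 * x₁ ≤ x → 0 ≤ y → y ≤ x →
        w x ≤ w y + w (x - y) - s * min (w y) (w (x - y))) ∧
      ∀ (n : ℕ) (_ : 0 < n) (ρ : EuclideanSpace ℝ (Fin n) → ℝ) (_ : UltraModulation.IsWindow ρ)
        (p q q' : ℝ≥0∞) [Fact (1 ≤ p)] (_ : 1 ≤ q) (_ : 1 / q + 1 / q' = 1),
        -- the modulation space is an algebra, the spaces with restricted Fourier support subalgebras
        UltraModulation.IsPointwiseAlgebra (UltraModulation.modulationSpace ρ w p q) ∧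
        (∀ (ε : Fin n → Fin 2) (R : ℝ), 2 ≤ R →
          UltraModulation.modulationSpaceOrthant ρ w p q ε R ⊆
              UltraModulation.modulationSpace ρ w p q ∧
            UltraModulation.IsPointwiseAlgebra
              (UltraModulation.modulationSpaceOrthant ρ w p q ε R)) ∧
        -- case (a): the lower limit `C₀` is positive, possibly infinite
        (∀ C₀ : ℝ≥0∞, 0 < C₀ → liminf (fun t : ℝ => ENNReal.ofReal (wt t)) atTop = C₀ →
          ∃ C : ℝ, 0 < C ∧
            (∀ (ε : Fin n → Fin 2) (R : ℝ), 2 ≤ R →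
              ∀ f ∈ UltraModulation.modulationSpaceOrthant ρ w p q ε R,
              ∀ g ∈ UltraModulation.modulationSpaceOrthant ρ w p q ε R,
                UltraModulation.modulationNorm ρ w p q (f * g) ≤
                  ENNReal.ofReal (C * UltraModulation.gammaTail (n / α) q'
                    (s * (min 1 C₀).toReal * (R - 2) ^ α)) *
                  UltraModulation.modulationNorm ρ w p q f *
                  UltraModulation.modulationNorm ρ w p q g) ∧
            Tendsto (fun R : ℝ => C * UltraModulation.gammaTail (n / α) q'
              (s * (min 1 C₀).toReal * (R - 2) ^ α)) atTop (𝓝 0)) ∧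
        -- case (b): the lower limit is zero
        (liminf (fun t : ℝ => ENNReal.ofReal (wt t)) atTop = 0 →
          ∀ δ : ℝ, 0 < δ → 0 < α - δ →
          ∃ C : ℝ, 0 < C ∧
            (∀ (ε : Fin n → Fin 2) (R : ℝ), 2 ≤ R →
              ∀ f ∈ UltraModulation.modulationSpaceOrthant ρ w p q ε R,
              ∀ g ∈ UltraModulation.modulationSpaceOrthant ρ w p q ε R,
                UltraModulation.modulationNorm ρ w p q (f * g) ≤
                  ENNReal.ofReal (C * UltraModulation.gammaTail (n / α) q'
                    (s * (R - 2) ^ (α - δ))) *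
                  UltraModulation.modulationNorm ρ w p q f *
                  UltraModulation.modulationNorm ρ w p q g) ∧
            Tendsto (fun R : ℝ => C * UltraModulation.gammaTail (n / α) q'
              (s * (R - 2) ^ (α - δ))) atTop (𝓝 0)) := by
  obtain ⟨hα0, hα1, hα⟩ := hw.isRegularlyVarying hwt hrep
  have hw' := hw.admissible
  obtain ⟨s, hs, hs1, x₁, hx₁, hsub⟩ := hw'.exists_strong_subadditive hα0.le hα1 hα
  -- One factor 2 is lost in summing over the lattice, another in the bound w(x) ≥ (c/2) x^α - K. A
  -- smaller s only weakens the subadditivity inequality, as w > 0.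
  refine ⟨s / 4, by positivity, ⟨x₁, hx₁, fun x y hx hy hyx => (hsub x y hx hy hyx).trans ?_⟩, ?_⟩
  · have := le_min (hw'.pos hy).le (hw'.pos (sub_nonneg.2 hyx)).le
    nlinarith
  intro n hn ρ hρ p q q' _ hq hqq
  have hq' := UltraModulation.one_le_conjugate hqq
  have hsub' : ∀ a : ℝ, 0 < a → ∃ C : ℝ, 0 ≤ C ∧ ∀ x y z : ℝ, 0 ≤ x → 0 ≤ y → 0 ≤ z →
      z ≤ x + y + a → w z ≤ w x + w y - s * min (w x) (w y) + C :=
    fun a ha => hw'.exists_le_add_sub_min hα0.le hα1 hα hs1 hx₁ hsub ha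
  -- This is where α < 1 ≤ n enters the lower bound for the Gamma tail.
  have hna : 1 ≤ n / α := by
    rw [one_le_div hα0]
    exact hα1.le.trans (by exact_mod_cast hn)
  obtain ⟨C, hC, hmul⟩ :=
    UltraModulation.exists_modulationNorm_mul_le_of_orthant hρ hw' hsub' hs hq hqq p
  refine ⟨UltraModulation.isPointwiseAlgebra_modulationSpace hρ hw' hs hsub' hq hqq p,
    fun ε R _ => ⟨fun f hf => hf.1,
      UltraModulation.isPointwiseAlgebra_modulationSpaceOrthant hρ hw' hs hsub' hq hqq p ε R⟩,
    fun C₀ hC₀ hlim => ?_, fun _ δ hδ hδα => ?_⟩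
  · have hc : 0 < (min 1 C₀).toReal :=
      ENNReal.toReal_pos (lt_min one_pos hC₀).ne' (min_lt_of_left_lt ENNReal.one_lt_top).ne
    obtain ⟨K, hK⟩ := hw'.exists_mul_rpow_le hα0 hrep hC₀ hlim
    obtain ⟨C', hC', hb⟩ := UltraModulation.exists_modulationNorm_mul_le_gammaTail
      (b := s / 4 * (min 1 C₀).toReal) (β := α) (K := s / 2 * K) hC hmul hna hq'
      (by positivity) fun x hx => by nlinarith [mul_le_mul_of_nonneg_left (hK x hx) hs.le]
    exact ⟨C', hC', hb, UltraModulation.tendsto_gammaTail_rpow (by linarith) hq' (by positivity)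
      hα0 C'⟩
  -- Here the coefficient of x^{α-δ} is 1, so s/2 would be available; s/4 is kept because one s must
  -- serve both cases.
  · obtain ⟨K, hK⟩ := hw'.exists_rpow_le hα hδ hδα
    obtain ⟨C', hC', hb⟩ := UltraModulation.exists_modulationNorm_mul_le_gammaTail
      (b := s / 4) (β := α - δ) (K := s / 2 * K) hC hmul hna hq'
      (by positivity) fun x hx => by
        nlinarith [mul_le_mul_of_nonneg_left (hK x hx) hs.le,
          mul_nonneg hs.le (Real.rpow_nonneg hx (α - δ))]
    exact ⟨C', hC', hb, UltraModulation.tendsto_gammaTail_rpow (by linarith) hq' (by positivity)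
      hδα C'⟩
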